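/- Let $F(s)=\sum_{n\ge1}a(n)n^{-s}$ belong to the extended Selberg class $\mathcal S^\sharp$: the series converges absolutely for $\sigma>1$ ($s=\sigma+it$) and does not vanish identically, $(s-1)^mF(s)$ extends to an entire function of finite order for some integer $m\ge0$, and $$F(s)\gamma(s)=\omega\,\overline{\gamma(1-\overline s)}\;\overline{F(1-\overline s)},\qquad \gamma(s)=Q^s\prod_{j=1}^r\Gamma(\lambda_js+\mu_j),$$ with $|\omega|=1$, $Q>0$, $r\ge0$, $\lambda_j>0$, $\Re\mu_j\ge0$. Put $d=2\sum_j\lambda_j$, $q=(2\pi)^dQ^2\prod_j\lambda_j^{2\lambda_j}$, $\theta_F=\frac1d\Im\big(2\sum_j(\mu_j-\tfrac12)\big)$, $s_\ell^*=\frac{d+1}{2d}-\frac{\ell}{d}-i\theta_F$, $n_\alpha=qd^{-d}\alpha^d$, and write $$2^r\prod_{j=1}^r\sin(\pi(\lambda_js+\mu_j))=\sum_{j=-N}^Na_je^{i\pi d\omega_js},\qquad -\tfrac12=\omega_{-N}<\dots<\omega_N=\tfrac12 .$$ Assume $d\ge1$. For $\alpha>0$, an integer $\ell\ge0$ and $\sigma>1$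 let $$\overline F_\ell(s,\alpha)=\sum_{j=-N}^Na_je^{i\pi d\omega_j(1-s)}\,\sideset{}{^\flat}\sum_{n\ge1}\frac{\overline{a(n)}}{n^s}\Big(1+e^{i\pi(\frac12-\omega_j)}\big(\tfrac{n_\alpha}{n}\big)^{1/d}\Big)^{d(1-s-s_\ell^*)},$$ where $^\flat$ means that for $j=-N$ the term $n=n_\alpha$ (if $n_\alpha$ is an integer) is omitted, and the powers are taken with arguments in $[0,\pi]$. Then there is a function $c:\mathbb R\to[0,\infty)$, with $c(\sigma)=0$ for $\sigma>1$, not depending on $\ell$ and $\alpha$, such that for all $\alpha>0$ and all integers $\ell\ge0$ the following holds. The inner series converge absolutely for $\sigma>1$, and $\overline F_\ell(s,\alpha)$ extends to an entire function that does not vanish identically. For every bounded interval $I$ and every $\delta>0$, $$\overline F_\ell(s,\alpha)\ll e^{\frac{\pi}{2}d|t|}|t|^{c(\sigma)}\qquad(|t|\ge1)$$ uniformly for $\sigma\in I\setminus(1,1+\delta)$; and for every bounded interval $I$ and every $\varepsilon>0$, $$\overline F_\ell(s,\alpha)\ll e^{\frac{\pi}{2}d|t|}|t|^{c(\sigma)+\varepsilon}\qquad(|t|\ge1)$$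 uniformly for $\sigma\in I$. The implied constants may depend on $F,\ell,\alpha,I$ and on $\delta$, respectively $\varepsilon$. -/

import Mathlib

open Complex Finset
open scoped ComplexConjugate

noncomputable section

namespace ExtSelberg

/-- The conjugate function `s ↦ conj (f (conj s))`. -/
def conjFn (f : ℂ → ℂ) (s : ℂ) : ℂ := conj (f (conj s))

/-- The data `Q, r, λ_j, μ_j, ω` of a functional equation of Riemann type. -/
structure GammaData where
  r : ℕ
  Q : ℝ
  lam : Fin r → ℝ
  mu : Fin r → ℂ
  omega : ℂ
  Q_pos : 0 < Q
  lam_pos : ∀ j, 0 < lam j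
  mu_re_nonneg : ∀ j, 0 ≤ (mu j).re
  norm_omega : ‖omega‖ = 1

namespace GammaData

variable (D : GammaData)

/-- The gamma factor `Q^s ∏ Γ(λ_j s + μ_j)`. -/
def gammaFactor (s : ℂ) : ℂ := (D.Q : ℂ) ^ s * ∏ j, Complex.Gamma (D.lam j * s + D.mu j)

/-- `s` is not a pole of any of the functions `Γ(λ_j s + μ_j)`. -/
def RegularAt (s : ℂ) : Prop := ∀ (j : Fin D.r) (k : ℕ), (D.lam j : ℂ) * s + D.mu j ≠ -(k : ℂ)

/-- The degree `d = 2 ∑ λ_j`. -/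
def degree : ℝ := 2 * ∑ j, D.lam j

/-- The conductor `q = (2π)^d Q² ∏ λ_j^(2 λ_j)`. -/
def conductor : ℝ :=
  (2 * Real.pi) ^ D.degree * D.Q ^ 2 * ∏ j, D.lam j ^ (2 * D.lam j)

/-- The invariant `ξ = 2 ∑ (μ_j - 1/2)`. -/
def xi : ℂ := 2 * ∑ j, (D.mu j - 1 / 2)

/-- The internal shift `θ`, given by `Im ξ = d θ`. -/
def theta : ℝ := D.xi.im / D.degree

/-- `s_ℓ^* = (d + 1) / (2 d) - ℓ / d - i θ`. -/
def sStar (l : ℕ) : ℂ :=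
  ((D.degree + 1) / (2 * D.degree) - l / D.degree : ℝ) - Complex.I * D.theta

/-- `n_α = q d^(-d) α^d`, a positive real number. -/
def nAlpha (α : ℝ) : ℝ := D.conductor * D.degree ^ (-D.degree) * α ^ D.degree

/-- The function `S_F(s) = 2^r ∏ sin(π (λ_j s + μ_j))`. -/
def sineProd (s : ℂ) : ℂ :=
  2 ^ D.r * ∏ j, Complex.sin (Real.pi * (D.lam j * s + D.mu j))

/-- The normalized frequency `d⁻¹ ∑ ε_j λ_j` attached to a choice of signs. -/
def signFreq (ε : Fin D.r → ℤˣ) : ℝ := (∑ j, ((ε j : ℤ) : ℝ) * D.lam j) / D.degree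

/-- The coefficient attached to a choice of signs when each factor of `sineProd` is expanded by
`2 sin w = -i e^(i w) + i e^(-i w)`. -/
def signCoeff (ε : Fin D.r → ℤˣ) : ℂ :=
  ∏ j, (-Complex.I * ((ε j : ℤ) : ℂ) *
    Complex.exp (Complex.I * Real.pi * ((ε j : ℤ) : ℂ) * D.mu j))

/-- The finite set of the distinct frequencies `ω_j` of `sineProd`. Its least element is `-1/2`
and its greatest element is `1/2` when `0 < r`. -/
def freqs : Finset ℝ := Finset.univ.image D.signFreq

/-- The coefficient of `e^(i π d w s)` in the expansion of `sineProd`. -/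
def coeff (w : ℝ) : ℂ := ∑ ε ∈ Finset.univ.filter (fun ε => D.signFreq ε = w), D.signCoeff ε

/-- `S_F(s) = ∑ a_j e^(i π d ω_j s)`. -/
theorem sineProd_eq_sum (s : ℂ) :
    D.sineProd s =
      ∑ w ∈ D.freqs, D.coeff w * Complex.exp (Complex.I * Real.pi * D.degree * w * s) := by
  have hdeg : ∀ ε : Fin D.r → ℤˣ,
      (D.degree : ℝ) * D.signFreq ε = ∑ j, ((ε j : ℤ) : ℝ) * D.lam j := by
    intro ε
    unfold signFreq
    by_cases h : D.degree = 0
    · have hr : IsEmpty (Fin D.r) := by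
        by_contra hne
        rw [not_isEmpty_iff] at hne
        have : 0 < ∑ j, D.lam j := Finset.sum_pos (fun j _ => D.lam_pos j) Finset.univ_nonempty
        unfold degree at h
        linarith
      simp
    · field_simp
  have h1 : ∀ w : ℂ, 2 * Complex.sin w =
      ∑ u : ℤˣ, (-Complex.I * ((u : ℤ) : ℂ) * Complex.exp (Complex.I * ((u : ℤ) : ℂ) * w)) := by
    intro w
    rw [UnitsInt.univ, Finset.sum_pair (by decide)]
    simp only [Complex.sin, Units.val_one, Units.val_neg, Int.cast_one, Int.cast_neg]
    ring_nf
  have h2 : D.sineProd s = ∑ ε : Fin D.r → ℤˣ,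
      D.signCoeff ε * Complex.exp (Complex.I * Real.pi * D.degree * D.signFreq ε * s) := by
    have : D.sineProd s = ∏ j, (2 * Complex.sin (Real.pi * (D.lam j * s + D.mu j))) := by
      rw [Finset.prod_mul_distrib]; simp [sineProd]
    rw [this]
    simp_rw [h1]
    rw [Finset.prod_univ_sum, Fintype.piFinset_univ]
    refine Finset.sum_congr rfl fun ε _ => ?_
    have h3 : Complex.I * Real.pi * D.degree * D.signFreq ε * s
        = ∑ j, Complex.I * Real.pi * ((ε j : ℤ) : ℂ) * D.lam j * s := by
      have := congrArg (fun x : ℝ => (x : ℂ)) (hdeg ε)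
      push_cast at this
      rw [show Complex.I * Real.pi * D.degree * D.signFreq ε * s
        = Complex.I * Real.pi * s * ((D.degree : ℂ) * D.signFreq ε) by ring, this, Finset.mul_sum]
      exact Finset.sum_congr rfl fun j _ => by ring
    rw [h3, Complex.exp_sum, signCoeff, ← Finset.prod_mul_distrib]
    refine Finset.prod_congr rfl fun j _ => ?_
    rw [mul_assoc _ (Complex.exp _) (Complex.exp _), ← Complex.exp_add]
    ring_nf
  rw [h2, freqs, ← Finset.sum_fiberwise_of_maps_to (s := Finset.univ)
    (t := Finset.univ.image D.signFreq) (g := D.signFreq)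
    (fun ε _ => Finset.mem_image_of_mem _ (Finset.mem_univ ε))]
  refine Finset.sum_congr rfl fun w _ => ?_
  rw [coeff, Finset.sum_mul]
  refine Finset.sum_congr rfl fun ε hε => ?_
  rw [(Finset.mem_filter.mp hε).2]

/-- The `n`-th term of the inner series of `F̄_ℓ(s, α)` with frequency `w`; it is set to zero for
`n = 0`, and for `n = n_α` if `w = -1/2`. For the other terms `1 + e^(i π (1/2 - w)) (n_α/n)^(1/d)`
is a nonzero point of the closed upper half plane, where the argument underlying the complex
power has values in `[0, π]`. -/
def innerTerm (a : ℕ → ℂ) (l : ℕ) (α : ℝ) (w : ℝ) (s : ℂ) (n : ℕ) : ℂ :=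
  if n = 0 ∨ (w = -(1 / 2) ∧ (n : ℝ) = D.nAlpha α) then 0
  else conj (a n) / (n : ℂ) ^ s *
    (1 + Complex.exp (Complex.I * Real.pi * (1 / 2 - w)) *
      (((D.nAlpha α / n) ^ (1 / D.degree) : ℝ) : ℂ)) ^ ((D.degree : ℂ) * (1 - s - D.sStar l))

/-- The function `F̄_ℓ(s, α)` as given by its series (meaningful for `Re s > 1`). -/
def fBar (a : ℕ → ℂ) (l : ℕ) (α : ℝ) (s : ℂ) : ℂ :=
  ∑ w ∈ D.freqs, D.coeff w * Complex.exp (Complex.I * Real.pi * D.degree * w * (1 - s)) *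
    ∑' n : ℕ, D.innerTerm a l α w s n

end GammaData

/-- A function has finite order: `f(s) ≪ exp(|s|^A)` for some `A`. -/
def FiniteOrder (f : ℂ → ℂ) : Prop :=
  ∃ A C : ℝ, ∀ s : ℂ, 1 ≤ ‖s‖ → ‖f s‖ ≤ C * Real.exp (‖s‖ ^ A)

/-- `F` is the element of the extended Selberg class with Dirichlet coefficients `a n`, `n ≥ 1`
(the value `a 0` plays no role), satisfying the functional equation with data `D`. The value of
`F` at a pole `s = 1` is irrelevant. -/
structure IsExtendedSelberg (a : ℕ → ℂ) (F : ℂ → ℂ) (D : GammaData) : Prop where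
  summable : ∀ s : ℂ, 1 < s.re → LSeriesSummable a s
  eq_LSeries : ∀ s : ℂ, 1 < s.re → F s = LSeries a s
  ne_zero : ∃ s : ℂ, 1 < s.re ∧ F s ≠ 0
  continuation : ∃ m : ℕ, Differentiable ℂ (fun s => (s - 1) ^ m * F s) ∧
    FiniteOrder (fun s => (s - 1) ^ m * F s)
  functional_equation : ∀ s : ℂ, s ≠ 0 → s ≠ 1 →
    D.RegularAt s → D.RegularAt (conj (1 - s)) →
    F s * D.gammaFactor s = D.omega * conjFn D.gammaFactor (1 - s) * conjFn F (1 - s)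

end ExtSelberg

end

open scoped Topology

namespace ExtSelberg

/-! The continuation comes from expanding the power binomially. Put `h(s) = S_F(1 - s) conj F(conj
s)`, β = d(1 - s - s_ℓ^*), and let z be the `shift` of the term (w, n), of modulus (n_α/n)^(1/d).
The k-th term of (1 + z)^β, summed over n, gives a Dirichlet series at s + k/d. Its phase
e^(iπ(1/2-w)k) = i^k e^(-iπwk) turns e^(iπdw(1-s)) into e^(iπdw(1-s-k/d)), so the sum over w
rebuilds the sine product (`sum_coeff_mul_freqExp`). Hence F̄_ℓ is a finite sum of i^k n_α^(k/d)
binom(β, k) h(s + k/d) over k < K plus a remainder (`fBar_eq`). The remainder gains n^(-K/d), so it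
is holomorphic for Re s > 1 - K/d. As K is arbitrary, the half planes patch together.

Two facts about h are needed. It is entire, because the functional equation shows that the sine
product removes the only possible pole (`exists_entire_sineProd_mul`). It is O(e^(πd|t|/2)) times a
power of |t| in strips: F grows polynomially by Phragmén–Lindelöf, and the sines account for the
exponential.

For the remainder, 0 ≤ arg(1 + z) ≤ π(1/2 - w) (`arg_one_add_exp_mem`) balances the frequency factor
against the complex power: their product is O(e^(πd|t|/2)) for every w (`norm_freqExp_mul_cpow_le`).
The powers of |t| depend only on K and on h, not on ℓ or α, which gives a common c(σ). For Re s ≥ 1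
+ δ one takes K = 0, and no power of |t| is lost; close to the line Re s = 1 the three lines theorem
costs |t|^ε.

For nonvanishing, restrict to Re s = 2. There F̄_ℓ is an absolutely convergent exponential sum in t
with exponents of real part at most πd/2. The terms with w = 1/2 attain this maximum, and their
exponents coincide with no others (`eq_of_lineExp_eq`), so a mean value isolates any nonzero
coefficient conj a(n₀). -/

/-! ### Ratios of gamma factors on vertical lines -/

/-- With b = x₂ - x₁, the quotient Γ(x₁ + iy)Γ(b)/Γ(x₂ + iy) is a Beta integral, dominated by the
same integral at y = 0. -/
theorem exists_norm_Gamma_le_of_lt {x₁ x₂ : ℝ} (h₁ : 0 < x₁) (h₂ : x₁ < x₂) :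
    ∃ C : ℝ, 0 ≤ C ∧ ∀ y : ℝ, ‖Gamma (x₁ + y * I)‖ ≤ C * ‖Gamma (x₂ + y * I)‖ := by
  set b : ℂ := ((x₂ - x₁ : ℝ) : ℂ) with hb
  have hbre : 0 < b.re := by simp [hb, h₂]
  have hG : Gamma b ≠ 0 := Gamma_ne_zero_of_re_pos hbre
  refine ⟨(∫ x in (0 : ℝ)..1, ‖(x : ℂ) ^ ((x₁ : ℂ) - 1) * (1 - (x : ℂ)) ^ (b - 1)‖) / ‖Gamma b‖,
    div_nonneg (intervalIntegral.integral_nonneg zero_le_one fun x _ => norm_nonneg _)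
      (norm_nonneg _), fun y => ?_⟩
  have hs : 0 < ((x₁ : ℂ) + y * I).re := by simpa using h₁
  have key := Gamma_mul_Gamma_eq_betaIntegral hs hbre
  have hsum : (x₁ : ℂ) + y * I + b = x₂ + y * I := by rw [hb]; push_cast; ring
  rw [hsum] at key
  have hB : ‖betaIntegral (x₁ + y * I) b‖ ≤
      ∫ x in (0 : ℝ)..1, ‖(x : ℂ) ^ ((x₁ : ℂ) - 1) * (1 - (x : ℂ)) ^ (b - 1)‖ := by
    refine (intervalIntegral.norm_integral_le_integral_norm zero_le_one).trans (le_of_eq ?_)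
    refine intervalIntegral.integral_congr_ae (Filter.Eventually.of_forall fun x hx => ?_)
    rw [Set.uIoc_of_le zero_le_one] at hx
    rw [norm_mul, norm_mul, norm_cpow_eq_rpow_re_of_pos hx.1, norm_cpow_eq_rpow_re_of_pos hx.1]
    simp
  have h := congrArg norm key
  rw [norm_mul, norm_mul] at h
  have hGn : 0 < ‖Gamma b‖ := norm_pos_iff.mpr hG
  rw [div_mul_eq_mul_div, le_div_iff₀ hGn, h, mul_comm]
  gcongr

theorem exists_norm_Gamma_add_nat_le (x : ℝ) (N : ℕ) :
    ∃ C : ℝ, 0 ≤ C ∧ ∀ y : ℝ, 1 ≤ |y| →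
      ‖Gamma ((x + N : ℝ) + y * I)‖ ≤ C * |y| ^ N * ‖Gamma (x + y * I)‖ := by
  induction N with
  | zero => exact ⟨1, zero_le_one, fun y _ => by simp⟩
  | succ N ih =>
    obtain ⟨C, hC, h⟩ := ih
    refine ⟨(|x + N| + 1) * C, by positivity, fun y hy => ?_⟩
    have hne : ((x + N : ℝ) : ℂ) + y * I ≠ 0 := by
      intro h0
      have := congrArg im h0
      simp at this
      rw [this] at hy; norm_num at hy
    have e : ((x + (N + 1 : ℕ) : ℝ) : ℂ) + y * I = ((x + N : ℝ) + y * I) + 1 := by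
      push_cast; ring
    rw [e, Gamma_add_one _ hne, norm_mul]
    have hn : ‖((x + N : ℝ) : ℂ) + y * I‖ ≤ (|x + N| + 1) * |y| := by
      refine (norm_add_le _ _).trans ?_
      simp only [norm_mul, norm_I, norm_real, Real.norm_eq_abs, mul_one]
      nlinarith [abs_nonneg (x + N)]
    calc _ ≤ ((|x + N| + 1) * |y|) * (C * |y| ^ N * ‖Gamma (x + y * I)‖) := by
          gcongr; exact h y hy
      _ = _ := by ring

/-- Polynomial comparison without Stirling: shift x₂ to the right by an integer until the Beta
integral applies, then return by the recurrence for Γ. Since |y| ≥ 1, a negative x₂ meets no pole.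
-/
theorem exists_norm_Gamma_le {x₁ : ℝ} (h₁ : 0 < x₁) (x₂ : ℝ) :
    ∃ (C : ℝ) (N : ℕ), 0 ≤ C ∧ ∀ y : ℝ, 1 ≤ |y| →
      ‖Gamma (x₁ + y * I)‖ ≤ C * |y| ^ N * ‖Gamma (x₂ + y * I)‖ := by
  obtain ⟨N, hN⟩ := exists_nat_gt (x₁ - x₂)
  obtain ⟨C₁, hC₁, H₁⟩ := exists_norm_Gamma_le_of_lt h₁ (show x₁ < x₂ + N by linarith)
  obtain ⟨C₂, hC₂, H₂⟩ := exists_norm_Gamma_add_nat_le x₂ N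
  refine ⟨C₁ * C₂, N, by positivity, fun y hy => ?_⟩
  calc _ ≤ C₁ * ‖Gamma ((x₂ + N : ℝ) + y * I)‖ := H₁ y
    _ ≤ C₁ * (C₂ * |y| ^ N * ‖Gamma (x₂ + y * I)‖) := by gcongr; exact H₂ y hy
    _ = _ := by ring

namespace GammaData

variable (D : GammaData)

theorem exists_norm_Gamma_factor_le (M : ℝ) (hM : 0 ≤ M) (j : Fin D.r) :
    ∃ (C T : ℝ) (N : ℕ), 0 ≤ C ∧ 0 ≤ T ∧ ∀ t : ℝ, T ≤ |t| → D.lam j * t + (D.mu j).im ≠ 0 ∧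
      ‖Gamma (D.lam j * ((1 + M : ℝ) + t * I) + D.mu j)‖ ≤
        C * |t| ^ N * ‖Gamma (D.lam j * ((-M : ℝ) + t * I) + D.mu j)‖ := by
  have hl := D.lam_pos j
  have hx : 0 < D.lam j * (1 + M) + (D.mu j).re := by
    have := D.mu_re_nonneg j; positivity
  obtain ⟨C, N, hC, H⟩ := exists_norm_Gamma_le hx (D.lam j * (-M) + (D.mu j).re)
  refine ⟨C * (D.lam j + |(D.mu j).im|) ^ N, 1 + (1 + |(D.mu j).im|) / D.lam j, N, by positivity,
    by positivity, fun t ht => ?_⟩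
  have h1 : 1 ≤ |t| := le_trans (by linarith [show 0 ≤ (1 + |(D.mu j).im|) / D.lam j by positivity]) ht
  have h2 : 1 + |(D.mu j).im| ≤ D.lam j * |t| := by
    have : (1 + |(D.mu j).im|) / D.lam j ≤ |t| := by linarith
    rw [div_le_iff₀ hl] at this
    linarith
  have h3 : |D.lam j * t| = D.lam j * |t| := by rw [abs_mul, abs_of_pos hl]
  have h4 : 1 ≤ |D.lam j * t + (D.mu j).im| := by
    have := abs_sub_abs_le_abs_sub (D.lam j * t) (-(D.mu j).im)
    rw [abs_neg, sub_neg_eq_add] at this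
    linarith
  have h5 : |D.lam j * t + (D.mu j).im| ≤ (D.lam j + |(D.mu j).im|) * |t| := by
    refine (abs_add_le _ _).trans ?_
    rw [h3]
    nlinarith [abs_nonneg (D.mu j).im]
  refine ⟨fun h => by rw [h] at h4; norm_num at h4, ?_⟩
  have e : ∀ u : ℝ, (D.lam j : ℂ) * ((u : ℝ) + t * I) + D.mu j =
      ((D.lam j * u + (D.mu j).re : ℝ) : ℂ) + ((D.lam j * t + (D.mu j).im : ℝ) : ℂ) * I := by
    intro u
    apply Complex.ext <;> simp
  rw [e, e]
  refine (H _ h4).trans ?_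
  rw [mul_assoc C (_ ^ N) (|t| ^ N), ← mul_pow]
  gcongr

theorem norm_Q_cpow (x t : ℝ) : ‖(D.Q : ℂ) ^ ((x : ℂ) + t * I)‖ = D.Q ^ x := by
  rw [norm_cpow_eq_rpow_re_of_pos D.Q_pos]; simp

/-- The two points are s = -M + it and conj (1 - s), so this is the quotient of gamma factors in the
functional equation on the left edge of a symmetric strip. -/
theorem exists_norm_gammaFactor_le (M : ℝ) (hM : 0 ≤ M) :
    ∃ (C T : ℝ) (N : ℕ), 0 ≤ C ∧ ∀ t : ℝ, T ≤ |t| →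
      (∀ j, D.lam j * t + (D.mu j).im ≠ 0) ∧
      ‖D.gammaFactor ((1 + M : ℝ) + t * I)‖ ≤ C * |t| ^ N * ‖D.gammaFactor ((-M : ℝ) + t * I)‖ := by
  choose C T N hC hT H using D.exists_norm_Gamma_factor_le M hM
  refine ⟨D.Q ^ (1 + 2 * M) * ∏ j, C j, ∑ j, T j, ∑ j, N j, ?_, fun t ht => ?_⟩
  · have := D.Q_pos
    have := Finset.prod_nonneg (s := Finset.univ) fun j _ => hC j
    positivity
  have hj : ∀ j, T j ≤ |t| := fun j =>
    (Finset.single_le_sum (fun i _ => hT i) (Finset.mem_univ j)).trans ht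
  refine ⟨fun j => (H j t (hj j)).1, ?_⟩
  rw [gammaFactor, gammaFactor, norm_mul, norm_mul, norm_Q_cpow, norm_Q_cpow, norm_prod, norm_prod]
  have hp : ∏ j, ‖Gamma (D.lam j * ((1 + M : ℝ) + t * I) + D.mu j)‖ ≤
      ∏ j, (C j * |t| ^ N j * ‖Gamma (D.lam j * ((-M : ℝ) + t * I) + D.mu j)‖) :=
    Finset.prod_le_prod (fun _ _ => norm_nonneg _) fun j _ => (H j t (hj j)).2
  rw [Finset.prod_mul_distrib, Finset.prod_mul_distrib, Finset.prod_pow_eq_pow_sum] at hp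
  have hQ : D.Q ^ (1 + M) = D.Q ^ (1 + 2 * M) * D.Q ^ (-M) := by
    rw [← Real.rpow_add D.Q_pos]; ring_nf
  have := D.Q_pos
  refine (mul_le_mul_of_nonneg_left hp (by positivity)).trans (le_of_eq ?_)
  rw [hQ]
  ring

theorem regularAt_of_im {s : ℂ} (h : ∀ j, D.lam j * s.im + (D.mu j).im ≠ 0) : D.RegularAt s := by
  intro j k hk
  have := congrArg im hk
  simp at this
  exact h j this

theorem regularAt_of_re_pos {s : ℂ} (h : 0 < s.re) : D.RegularAt s := by
  intro j k hk
  have := congrArg re hk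
  simp at this
  have h1 := mul_pos (D.lam_pos j) h
  have h2 := D.mu_re_nonneg j
  have h3 : (0 : ℝ) ≤ k := k.cast_nonneg
  linarith

theorem gammaFactor_ne_zero {s : ℂ} (h : D.RegularAt s) : D.gammaFactor s ≠ 0 := by
  refine mul_ne_zero ?_ (Finset.prod_ne_zero_iff.mpr fun j _ => Gamma_ne_zero fun k => h j k)
  rw [Ne, cpow_eq_zero_iff]
  simp [D.Q_pos.ne']

end GammaData

/-! ### Polynomial growth of F in vertical strips -/

theorem norm_conjFn (f : ℂ → ℂ) (s : ℂ) : ‖conjFn f s‖ = ‖f (conj s)‖ := by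
  rw [conjFn, norm_conj]

/-- A function of finite order which is polynomially bounded on the edges of a vertical strip is
polynomially bounded inside. -/
theorem FiniteOrder.norm_le_of_edges {f : ℂ → ℂ} (hf : Differentiable ℂ f) (hfo : FiniteOrder f)
    {a b C : ℝ} (hab : a < b) (N : ℕ) (hC : 0 ≤ C)
    (ha : ∀ s : ℂ, s.re = a → ‖f s‖ ≤ C * (1 + |s.im|) ^ N)
    (hb : ∀ s : ℂ, s.re = b → ‖f s‖ ≤ C * (1 + |s.im|) ^ N) :
    ∃ C' : ℝ, 0 ≤ C' ∧ ∀ s : ℂ, a ≤ s.re → s.re ≤ b → ‖f s‖ ≤ C' * (1 + |s.im|) ^ N := by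
  obtain ⟨A, B, hAB⟩ := hfo
  have hre : ∀ s : ℂ, a ≤ s.re → 1 ≤ ‖s + (1 - a : ℝ)‖ := fun s hs => by
    refine le_trans ?_ (re_le_norm _)
    simp; linarith
  have him : ∀ s : ℂ, |s.im| ≤ ‖s + (1 - a : ℝ)‖ := fun s => by
    have := abs_im_le_norm (s + (1 - a : ℝ))
    simpa using this
  have hlow : ∀ s : ℂ, a ≤ s.re → (1 + |s.im|) ^ N ≤ 2 ^ N * ‖s + (1 - a : ℝ)‖ ^ N := fun s hs => by
    rw [← mul_pow]
    have := hre s hs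
    have := him s
    gcongr
    linarith
  have hne : ∀ s : ℂ, a ≤ s.re → s + (1 - a : ℝ) ≠ 0 := fun s hs h => by
    have := hre s hs
    rw [h, norm_zero] at this
    norm_num at this
  -- On the strip Re(s + 1 - a) ≥ 1, so the denominator has no zero and dominates (1 + |t|)^N up to
  -- 2^N; g is thus bounded on both edges.
  set g : ℂ → ℂ := fun s => f s / (s + (1 - a : ℝ)) ^ N with hg
  have edge : ∀ s : ℂ, a ≤ s.re → ‖f s‖ ≤ C * (1 + |s.im|) ^ N → ‖g s‖ ≤ C * 2 ^ N := by
    intro s hs h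
    have h1 := hre s hs
    have h2 := hlow s hs
    rw [hg]
    simp only
    rw [norm_div, norm_pow, div_le_iff₀ (by positivity)]
    calc _ ≤ _ := h
      _ ≤ C * (2 ^ N * ‖s + (1 - a : ℝ)‖ ^ N) := by gcongr
      _ = _ := by ring
  have hcl : closure (re ⁻¹' Set.Ioo a b) ⊆ re ⁻¹' Set.Icc a b :=
    closure_minimal (Set.preimage_mono Set.Ioo_subset_Icc_self)
      (isClosed_Icc.preimage continuous_re)
  have hd : DiffContOnCl ℂ g (re ⁻¹' Set.Ioo a b) := by
    refine DifferentiableOn.diffContOnCl fun s hs => DifferentiableAt.differentiableWithinAt ?_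
    refine (hf s).div (by fun_prop) (pow_ne_zero _ (hne s (hcl hs).1))
  -- Finite order gives exp(|s|^A), far below the double exponential allowed in a strip.
  have hgrowth : ∃ c < Real.pi / (b - a), ∃ B,
      g =O[Filter.comap (_root_.abs ∘ im) Filter.atTop ⊓ Filter.principal (re ⁻¹' Set.Ioo a b)]
        fun z => Real.exp (B * Real.exp (c * |z.im|)) := by
    have hpos : 0 < Real.pi / (b - a) := div_pos Real.pi_pos (by linarith)
    set c := Real.pi / (b - a) / 2 with hc
    set A' := max A 0 with hA'
    set R := |a| + |b| + 1 with hR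
    refine ⟨c, by rw [hc]; linarith, R ^ A', Asymptotics.IsBigO.of_bound (max B 0) ?_⟩
    have h1 : ∀ᶠ u : ℝ in Filter.atTop, u ^ A' ≤ Real.exp (c * u) := by
      have := (isLittleO_rpow_exp_pos_mul_atTop A' (show 0 < c by rw [hc]; linarith)).bound one_pos
      filter_upwards [this, Filter.eventually_ge_atTop 0] with u hu h0
      rwa [one_mul, Real.norm_eq_abs, Real.norm_eq_abs, abs_of_pos (Real.exp_pos _),
        abs_of_nonneg (by positivity)] at hu
    have h2 : ∀ᶠ z : ℂ in Filter.comap (_root_.abs ∘ im) Filter.atTop,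
        1 ≤ |z.im| ∧ |z.im| ^ A' ≤ Real.exp (c * |z.im|) :=
      Filter.Eventually.comap ((Filter.eventually_ge_atTop 1).and h1) (_root_.abs ∘ im)
    have h3 : ∀ᶠ z : ℂ in Filter.principal (re ⁻¹' Set.Ioo a b), z ∈ re ⁻¹' Set.Ioo a b :=
      Filter.mem_principal_self _
    filter_upwards [Filter.mem_inf_of_left h2, Filter.mem_inf_of_right h3] with z hz hz'
    obtain ⟨hz1, hz2⟩ := hz
    obtain ⟨hza, hzb⟩ := hz'
    have hz1' : 1 ≤ ‖z‖ := hz1.trans (abs_im_le_norm z)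
    have hzR : ‖z‖ ≤ R * |z.im| := by
      refine (norm_le_abs_re_add_abs_im z).trans ?_
      have : |z.re| ≤ |a| + |b| := by
        rw [abs_le]
        constructor
        · linarith [neg_abs_le a, abs_nonneg b]
        · linarith [le_abs_self b, abs_nonneg a]
      nlinarith [abs_nonneg a, abs_nonneg b]
    have hgf : ‖g z‖ ≤ ‖f z‖ := by
      rw [hg]
      simp only
      rw [norm_div, norm_pow]
      exact div_le_self (norm_nonneg _) (one_le_pow₀ (hre z hza.le))
    rw [Real.norm_eq_abs, abs_of_pos (Real.exp_pos _)]
    calc ‖g z‖ ≤ B * Real.exp (‖z‖ ^ A) := hgf.trans (hAB z hz1')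
      _ ≤ max B 0 * Real.exp (‖z‖ ^ A) := by gcongr; exact le_max_left _ _
      _ ≤ max B 0 * Real.exp (R ^ A' * Real.exp (c * |z.im|)) := by
        gcongr
        calc ‖z‖ ^ A ≤ ‖z‖ ^ A' := Real.rpow_le_rpow_of_exponent_le hz1' (le_max_left _ _)
          _ ≤ (R * |z.im|) ^ A' := Real.rpow_le_rpow (norm_nonneg _) hzR (le_max_right _ _)
          _ = R ^ A' * |z.im| ^ A' := Real.mul_rpow (by positivity) (abs_nonneg _)
          _ ≤ _ := by gcongr
  refine ⟨C * 2 ^ N * (|a| + |b| + 1 + |1 - a|) ^ N, by positivity, fun s hsa hsb => ?_⟩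
  have hs := PhragmenLindelof.vertical_strip hd hgrowth
    (fun z hz => edge z hz.ge (ha z hz)) (fun z hz => edge z (hz ▸ hab.le) (hb z hz)) hsa hsb
  have hfg : f s = g s * (s + (1 - a : ℝ)) ^ N := by
    rw [hg]; simp only
    rw [div_mul_cancel₀ _ (pow_ne_zero _ (hne s hsa))]
  rw [hfg, norm_mul, norm_pow, mul_assoc, ← mul_pow]
  gcongr
  refine (norm_add_le _ _).trans ?_
  have h1 := norm_le_abs_re_add_abs_im s
  rw [norm_real, Real.norm_eq_abs]
  have : |s.re| ≤ |a| + |b| := by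
    rw [abs_le]
    constructor
    · linarith [neg_abs_le a, abs_nonneg b]
    · linarith [le_abs_self b, abs_nonneg a]
  nlinarith [abs_nonneg a, abs_nonneg b, abs_nonneg (1 - a), abs_nonneg s.im]

namespace IsExtendedSelberg

variable {a : ℕ → ℂ} {F : ℂ → ℂ} {D : GammaData}

theorem norm_le_tsum (hF : IsExtendedSelberg a F D) {x : ℝ} (hx : 1 < x) :
    ∃ A : ℝ, 0 ≤ A ∧ ∀ s : ℂ, x ≤ s.re → ‖F s‖ ≤ A := by
  refine ⟨∑' n, ‖LSeries.term a x n‖, tsum_nonneg fun _ => norm_nonneg _, fun s hs => ?_⟩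
  rw [hF.eq_LSeries s (by linarith)]
  have h1 := (hF.summable x (by simpa using hx)).norm
  have h2 := (hF.summable s (by linarith)).norm
  refine (norm_tsum_le_tsum_norm h2).trans (h2.tsum_le_tsum (fun n => ?_) h1)
  exact LSeries.norm_term_le_of_re_le_re a (by simpa using hs) n

/-- The right edge is in the region of absolute convergence. On the left edge the functional
equation and the gamma quotient handle large positive heights `T ≤ |t|`; compactness handles the
rest. Phragmén–Lindelöf fills the strip. -/
theorem norm_mul_pow_le (hF : IsExtendedSelberg a F D) {m : ℕ}
    (hm : Differentiable ℂ (fun s => (s - 1) ^ m * F s))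
    (hfo : FiniteOrder (fun s => (s - 1) ^ m * F s)) {M : ℝ} (hM : 1 ≤ M) :
    ∃ (C : ℝ) (N : ℕ), 0 ≤ C ∧ ∀ s : ℂ, -M ≤ s.re → s.re ≤ 1 + M →
      ‖(s - 1) ^ m * F s‖ ≤ C * (1 + |s.im|) ^ N := by
  obtain ⟨A, hA, hFA⟩ := hF.norm_le_tsum (show 1 < 1 + M by linarith)
  obtain ⟨C₁, T, N, hC₁, hγ⟩ := D.exists_norm_gammaFactor_le M (by linarith)
  obtain ⟨C₂, hC₂⟩ := (isCompact_Icc (a := -|T|) (b := |T|)).exists_bound_of_continuousOn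
    (f := fun t : ℝ => (((-M : ℝ) + t * I : ℂ) - 1) ^ m * F ((-M : ℝ) + t * I))
    (hm.continuous.comp (by fun_prop : Continuous fun t : ℝ => ((-M : ℝ) + t * I : ℂ))).continuousOn
  have hpow : ∀ s : ℂ, -M ≤ s.re → s.re ≤ 1 + M →
      ‖(s - 1) ^ m‖ ≤ ((1 + M) * (1 + |s.im|)) ^ m := by
    intro s h1 h2
    rw [norm_pow]
    gcongr
    refine (norm_le_abs_re_add_abs_im _).trans ?_
    have : |(s - 1).re| ≤ 1 + M := by
      rw [abs_le]; simp; constructor <;> linarith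
    have h3 : (s - 1).im = s.im := by simp
    rw [h3]
    nlinarith [abs_nonneg s.im]
  set C := max |C₂| ((1 + M) ^ m * (A + C₁ * A)) with hC
  have hC0 : 0 ≤ C := le_max_of_le_left (abs_nonneg _)
  have hgen : ∀ s : ℂ, -M ≤ s.re → s.re ≤ 1 + M → ‖F s‖ ≤ (A + C₁ * A) * (1 + |s.im|) ^ N →
      ‖(s - 1) ^ m * F s‖ ≤ C * (1 + |s.im|) ^ (m + N) := by
    intro s h1 h2 h3
    rw [norm_mul]
    calc _ ≤ ((1 + M) * (1 + |s.im|)) ^ m * ((A + C₁ * A) * (1 + |s.im|) ^ N) := by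
          gcongr; exact hpow s h1 h2
      _ = ((1 + M) ^ m * (A + C₁ * A)) * (1 + |s.im|) ^ (m + N) := by rw [mul_pow, pow_add]; ring
      _ ≤ _ := by gcongr; exact le_max_right _ _
  have hout := fun hl hr => hfo.norm_le_of_edges hm (show -M < 1 + M by linarith) (m + N) hC0 hl hr
  suffices h : (∀ s : ℂ, s.re = -M → ‖(s - 1) ^ m * F s‖ ≤ C * (1 + |s.im|) ^ (m + N)) ∧
      ∀ s : ℂ, s.re = 1 + M → ‖(s - 1) ^ m * F s‖ ≤ C * (1 + |s.im|) ^ (m + N) by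
    obtain ⟨C', hC', h'⟩ := hout h.1 h.2
    exact ⟨C', m + N, hC', h'⟩
  refine ⟨fun s hs => ?_, fun s hs => ?_⟩
  · have hse : s = (-M : ℝ) + s.im * I := by rw [← hs]; exact (re_add_im s).symm
    rcases le_total T |s.im| with ht | ht
    · refine hgen s hs.ge (by linarith) ?_
      obtain ⟨hreg, hratio⟩ := hγ _ ht
      have hs' : conj (1 - s) = (1 + M : ℝ) + s.im * I := by
        apply Complex.ext <;> simp [hs]
      have hr := D.regularAt_of_im hreg
      have hfe := hF.functional_equation s (by rintro rfl; simp at hs; linarith)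
        (by rintro rfl; simp at hs; linarith) hr
        (D.regularAt_of_re_pos (by rw [hs']; simp; linarith))
      have hn := congrArg norm hfe
      rw [norm_mul, norm_mul, norm_mul, norm_conjFn, norm_conjFn, D.norm_omega, one_mul, hs'] at hn
      rw [← hse] at hratio
      have hpos : 0 < ‖D.gammaFactor s‖ := norm_pos_iff.mpr (D.gammaFactor_ne_zero hr)
      have h4 : ‖F ((1 + M : ℝ) + s.im * I)‖ ≤ A := hFA _ (by simp)
      have h5 : |s.im| ^ N ≤ (1 + |s.im|) ^ N := by gcongr; linarith
      have h6 : ‖F s‖ * ‖D.gammaFactor s‖ ≤ (C₁ * (1 + |s.im|) ^ N * A) * ‖D.gammaFactor s‖ := by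
        rw [hn]
        calc _ ≤ (C₁ * |s.im| ^ N * ‖D.gammaFactor s‖) * A := by gcongr
          _ ≤ (C₁ * (1 + |s.im|) ^ N * ‖D.gammaFactor s‖) * A := by gcongr
          _ = _ := by ring
      refine (le_of_mul_le_mul_right h6 hpos).trans ?_
      have : 0 ≤ A * (1 + |s.im|) ^ N := by positivity
      nlinarith
    · have h := hC₂ s.im (abs_le.mp (ht.trans (le_abs_self T)))
      rw [← hse] at h
      have hCC : C₂ ≤ C := (le_abs_self _).trans (le_max_left _ _)
      refine (h.trans hCC).trans ?_
      exact le_mul_of_one_le_right hC0 (one_le_pow₀ (by linarith [abs_nonneg s.im]))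
  · refine hgen s (by linarith) hs.le ((hFA s hs.ge).trans ?_)
    have h1 : 1 ≤ (1 + |s.im|) ^ N := one_le_pow₀ (by linarith [abs_nonneg s.im])
    have : 0 ≤ C₁ * A := by positivity
    nlinarith

end IsExtendedSelberg

/-! ### The sine product and the cancellation of poles -/

theorem norm_sin_le_exp (z : ℂ) : ‖sin z‖ ≤ Real.exp |z.im| := by
  rw [sin, norm_div, norm_mul, norm_I, mul_one, RCLike.norm_ofNat, div_le_iff₀ two_pos]
  refine (norm_sub_le _ _).trans ?_
  rw [norm_exp, norm_exp]
  have h1 : Real.exp (-z * I).re ≤ Real.exp |z.im| := by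
    gcongr; simpa using le_abs_self z.im
  have h2 : Real.exp (z * I).re ≤ Real.exp |z.im| := by
    gcongr; simpa using neg_le_abs z.im
  linarith

namespace GammaData

variable (D : GammaData)

theorem differentiable_sineProd : Differentiable ℂ D.sineProd := by
  unfold sineProd
  fun_prop

/-- The sines contribute exp(π λ_j |t|) each, and the λ_j add up to d/2. -/
theorem exists_norm_sineProd_le : ∃ C : ℝ, 0 ≤ C ∧ ∀ s : ℂ,
    ‖D.sineProd (1 - s)‖ ≤ C * Real.exp (Real.pi / 2 * D.degree * |s.im|) := by
  refine ⟨2 ^ D.r * ∏ j, Real.exp (Real.pi * |(D.mu j).im|), by positivity, fun s => ?_⟩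
  have h : ∀ j, ‖sin (Real.pi * (D.lam j * (1 - s) + D.mu j))‖ ≤
      Real.exp (Real.pi * |(D.mu j).im|) * Real.exp (Real.pi * D.lam j * |s.im|) := fun j => by
    refine (norm_sin_le_exp _).trans ?_
    rw [← Real.exp_add]
    gcongr
    have e : ((Real.pi : ℂ) * (D.lam j * (1 - s) + D.mu j)).im =
        Real.pi * (D.mu j).im - Real.pi * D.lam j * s.im := by
      simp; ring
    rw [e]
    refine (abs_sub _ _).trans ?_
    rw [abs_mul, abs_mul, abs_mul, abs_of_pos Real.pi_pos, abs_of_pos (D.lam_pos j)]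
  have hp := Finset.prod_le_prod (s := Finset.univ) (fun j _ => norm_nonneg _) fun j _ => h j
  rw [Finset.prod_mul_distrib, ← Real.exp_sum _ fun j => Real.pi * D.lam j * |s.im|,
    ← Finset.sum_mul, ← Finset.mul_sum] at hp
  rw [sineProd, norm_mul, norm_pow, RCLike.norm_ofNat, norm_prod, mul_assoc]
  refine mul_le_mul_of_nonneg_left (hp.trans (le_of_eq ?_)) (by positivity)
  rw [degree]
  congr 2
  ring

/-- The reflection formula for a single factor. -/
theorem sin_mul_Gamma {w : ℂ} (hw : ∀ k : ℕ, w ≠ -k) :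
    sin (Real.pi * w) * Gamma w = Real.pi * (Gamma (1 - w))⁻¹ := by
  -- If the sine vanishes, w is a positive integer by `hw`. Then Γ(1 - w) has a pole, where `Gamma`
  -- and its inverse both take the value 0, so both sides are 0.
  by_cases h : sin (Real.pi * w) = 0
  · obtain ⟨k, hk⟩ := Complex.sin_eq_zero_iff.mp h
    have hwk : w = k := by
      have : (Real.pi : ℂ) ≠ 0 := by exact_mod_cast Real.pi_ne_zero
      apply mul_left_cancel₀ this
      rw [hk, mul_comm]
    have h0 : Gamma (1 - w) = 0 := by
      rw [Complex.Gamma_eq_zero_iff]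
      rcases lt_or_ge k 1 with hk1 | hk1
      · exfalso
        refine hw k.natAbs ?_
        rw [hwk, Nat.cast_natAbs, abs_of_nonpos (by lia)]
        push_cast; ring
      · refine ⟨(k - 1).natAbs, ?_⟩
        rw [hwk, Nat.cast_natAbs, abs_of_nonneg (by lia)]
        push_cast; ring
    rw [h, h0]; simp
  · have hr := Complex.Gamma_mul_Gamma_one_sub w
    have h0 : Gamma (1 - w) ≠ 0 := by
      intro h0
      rw [h0, mul_zero, eq_comm, div_eq_zero_iff] at hr
      rcases hr with hr | hr
      · exact Real.pi_ne_zero (by exact_mod_cast hr)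
      · exact h hr
    rw [eq_div_iff h] at hr
    rw [← div_eq_mul_inv, eq_div_iff h0]
    linear_combination hr

/-- The right side involves only reciprocals of Γ and is entire: the sines cancel every pole of the
gamma factor. -/
theorem sineProd_mul_gammaFactor {s : ℂ} (hs : D.RegularAt s) :
    D.sineProd s * D.gammaFactor s =
      2 ^ D.r * (D.Q : ℂ) ^ s * ∏ j, ((Real.pi : ℂ) * (Gamma (1 - (D.lam j * s + D.mu j)))⁻¹) := by
  rw [sineProd, gammaFactor]
  have : (∏ j, sin (Real.pi * (D.lam j * s + D.mu j))) * ∏ j, Gamma (D.lam j * s + D.mu j) =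
      ∏ j, ((Real.pi : ℂ) * (Gamma (1 - (D.lam j * s + D.mu j)))⁻¹) := by
    rw [← Finset.prod_mul_distrib]
    exact Finset.prod_congr rfl fun j _ => sin_mul_Gamma fun k => hs j k
  rw [← this]
  ring

/-- The functional equation is available only at regular points. The irregular ones are zeros of the
entire functions 1/Γ(λ_j s + μ_j), hence isolated, even if 0 is one of them. -/
theorem eventually_regularAt_near_zero : ∀ᶠ s : ℂ in 𝓝[≠] 0, D.RegularAt s := by
  have : ∀ j : Fin D.r, ∀ᶠ s : ℂ in 𝓝[≠] 0, ∀ k : ℕ, (D.lam j : ℂ) * s + D.mu j ≠ -k := by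
    intro j
    have hl : (D.lam j : ℂ) ≠ 0 := by exact_mod_cast (D.lam_pos j).ne'
    have hd : Differentiable ℂ fun s : ℂ => (Gamma (D.lam j * s + D.mu j))⁻¹ :=
      differentiable_one_div_Gamma.comp (by fun_prop)
    have ha : AnalyticAt ℂ (fun s : ℂ => (Gamma (D.lam j * s + D.mu j))⁻¹) 0 := hd.analyticAt 0
    rcases ha.eventually_eq_zero_or_eventually_ne_zero with h | h
    · exfalso
      -- 1/Γ(λ_j s + μ_j) is not identically zero: at s = (1 - μ_j)/λ_j it equals 1/Γ(1) = 1.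
      have h1 := AnalyticOnNhd.eqOn_of_preconnected_of_eventuallyEq
        (f := fun s : ℂ => (Gamma (D.lam j * s + D.mu j))⁻¹) (g := fun _ => 0)
        (fun z _ => hd.analyticAt z) (fun z _ => analyticAt_const) isPreconnected_univ
        (Set.mem_univ 0) h (Set.mem_univ ((1 - D.mu j) / D.lam j))
      simp only at h1
      rw [mul_div_cancel₀ _ hl] at h1
      simp at h1
    · filter_upwards [h] with s hs k hk
      rw [hk, Complex.Gamma_neg_nat_eq_zero] at hs
      simp at hs
  rw [← Filter.eventually_all] at this
  exact this

theorem conj_gammaFactor_differentiableAt {s : ℂ} (hs : 0 < s.re) :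
    DifferentiableAt ℂ (conjFn D.gammaFactor) s := by
  have : DifferentiableAt ℂ D.gammaFactor (conj s) := by
    unfold gammaFactor
    refine DifferentiableAt.mul (DifferentiableAt.const_cpow differentiableAt_id
      (Or.inl (by exact_mod_cast D.Q_pos.ne'))) ?_
    refine DifferentiableAt.fun_finsetProd fun j _ => ?_
    refine (Complex.differentiableAt_Gamma _ fun k => ?_).comp _ (by fun_prop)
    exact D.regularAt_of_re_pos (by simpa using hs) j k
  have := this.conj_conj
  rwa [conj_conj] at this

end GammaData

namespace IsExtendedSelberg

variable {a : ℕ → ℂ} {F : ℂ → ℂ} {D : GammaData}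

theorem differentiableAt_of_ne_one (hF : IsExtendedSelberg a F D) {s : ℂ} (hs : s ≠ 1) :
    DifferentiableAt ℂ F s := by
  obtain ⟨m, hm, -⟩ := hF.continuation
  have h : DifferentiableAt ℂ (fun z => (z - 1) ^ m * F z / (z - 1) ^ m) s :=
    (hm s).div (by fun_prop) (pow_ne_zero _ (sub_ne_zero.mpr hs))
  refine h.congr_of_eventuallyEq ?_
  filter_upwards [isOpen_ne.mem_nhds hs] with z hz
  rw [mul_div_cancel_left₀ _ (pow_ne_zero _ (sub_ne_zero.mpr hz))]

/-- The poles of `F̄` are cancelled by the zeros of the sine product. -/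
theorem exists_entire_sineProd_mul (hF : IsExtendedSelberg a F D) :
    ∃ h : ℂ → ℂ, Differentiable ℂ h ∧ ∀ s, s ≠ 1 → h s = D.sineProd (1 - s) * conjFn F s := by
  -- The product S_F(1 - s) conj F(conj s), rewritten by the functional equation at 1 - s. Near s =
  -- 1 this form is regular: F is evaluated near 0, away from its pole, and the denominator does not
  -- vanish for Re s > 0.
  set g : ℂ → ℂ := fun s => 2 ^ D.r * (D.Q : ℂ) ^ (1 - s) *
    (∏ j, ((Real.pi : ℂ) * (Gamma (1 - (D.lam j * (1 - s) + D.mu j)))⁻¹)) * F (1 - s) /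
      (D.omega * conjFn D.gammaFactor s) with hg
  have homega : D.omega ≠ 0 := norm_ne_zero_iff.mp (by rw [D.norm_omega]; norm_num)
  have hγ : ∀ s : ℂ, 0 < s.re → conjFn D.gammaFactor s ≠ 0 := fun s hs => by
    rw [← norm_ne_zero_iff, norm_conjFn, norm_ne_zero_iff]
    exact D.gammaFactor_ne_zero (D.regularAt_of_re_pos (by simpa using hs))
  have hgd : DifferentiableAt ℂ g 1 := by
    refine DifferentiableAt.div (DifferentiableAt.mul (DifferentiableAt.mul
      (DifferentiableAt.mul (by fun_prop) ?_) ?_) ?_)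
      (DifferentiableAt.mul (by fun_prop) (D.conj_gammaFactor_differentiableAt (by simp)))
      (mul_ne_zero homega (hγ 1 (by simp)))
    · exact DifferentiableAt.const_cpow (by fun_prop) (Or.inl (by exact_mod_cast D.Q_pos.ne'))
    · refine DifferentiableAt.fun_finsetProd fun j _ => DifferentiableAt.const_mul ?_ _
      exact (differentiable_one_div_Gamma.comp
        (by fun_prop : Differentiable ℂ fun s : ℂ => 1 - (D.lam j * (1 - s) + D.mu j))) 1
    · exact DifferentiableAt.comp (1 : ℂ) (hF.differentiableAt_of_ne_one (by simp)) (by fun_prop)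
  have hev : ∀ᶠ s in 𝓝[≠] (1 : ℂ), D.sineProd (1 - s) * conjFn F s = g s := by
    have h1 : Filter.Tendsto (fun s : ℂ => 1 - s) (𝓝[≠] 1) (𝓝[≠] 0) := by
      refine tendsto_nhdsWithin_iff.mpr ⟨?_, ?_⟩
      · have : Filter.Tendsto (fun s : ℂ => 1 - s) (𝓝 1) (𝓝 (1 - 1)) :=
          (continuous_const.sub continuous_id).tendsto 1
        rw [sub_self] at this
        exact this.mono_left nhdsWithin_le_nhds
      · filter_upwards [self_mem_nhdsWithin] with s hs
        exact sub_ne_zero.mpr (Ne.symm hs)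
    have h2 : ∀ᶠ s : ℂ in 𝓝[≠] 1, 0 < s.re :=
      (continuous_re.continuousAt.eventually_const_lt (by simp : (0 : ℝ) < (1 : ℂ).re)).filter_mono
        nhdsWithin_le_nhds
    have h3 : ∀ᶠ s : ℂ in 𝓝[≠] 1, s ≠ 1 := self_mem_nhdsWithin
    filter_upwards [h1.eventually D.eventually_regularAt_near_zero, h2, h3] with s hs hre hne
    have hs0 : s ≠ 0 := by rintro rfl; simp at hre
    have hfe := hF.functional_equation (1 - s) (sub_ne_zero.mpr (Ne.symm hne)) (by simpa using hs0)
      hs (D.regularAt_of_re_pos (by simpa using hre))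
    rw [sub_sub_cancel] at hfe
    rw [hg]
    simp only
    rw [← D.sineProd_mul_gammaFactor hs, eq_div_iff (mul_ne_zero homega (hγ s hre))]
    linear_combination (-D.sineProd (1 - s)) * hfe
  -- The value of F at 1 is arbitrary, so the product has to be redefined there.
  refine ⟨Function.update (fun s => D.sineProd (1 - s) * conjFn F s) 1 (g 1), fun s => ?_,
    fun s hs => Function.update_of_ne hs _ _⟩
  by_cases hs : s = 1
  · rw [hs]
    refine hgd.congr_of_eventuallyEq ?_
    rw [eventually_nhdsWithin_iff] at hev
    filter_upwards [hev] with z hz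
    by_cases h1 : z = 1
    · rw [h1, Function.update_self]
    · rw [Function.update_of_ne h1]; exact hz h1
  · have h1 : DifferentiableAt ℂ (fun s => D.sineProd (1 - s) * conjFn F s) s := by
      refine (D.differentiable_sineProd.comp (by fun_prop : Differentiable ℂ fun s : ℂ => 1 - s)
        s).mul ?_
      have : DifferentiableAt ℂ F (conj s) := hF.differentiableAt_of_ne_one fun h => hs (by
        rw [← conj_conj s, h, map_one])
      have := this.conj_conj
      rwa [conj_conj] at this
    refine h1.congr_of_eventuallyEq ?_
    filter_upwards [isOpen_ne.mem_nhds hs] with z hz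
    rw [Function.update_of_ne hz]

theorem exists_norm_sineProd_mul_le (hF : IsExtendedSelberg a F D) (x y : ℝ) :
    ∃ (C : ℝ) (N : ℕ), 0 ≤ C ∧ ∀ s : ℂ, x ≤ s.re → s.re ≤ y → 1 ≤ |s.im| →
      ‖D.sineProd (1 - s) * conjFn F s‖ ≤
        C * Real.exp (Real.pi / 2 * D.degree * |s.im|) * |s.im| ^ N := by
  obtain ⟨m, hm, hfo⟩ := hF.continuation
  obtain ⟨C₁, N, hC₁, h₁⟩ := hF.norm_mul_pow_le hm hfo
    (show 1 ≤ 1 + |x| + |y| by linarith [abs_nonneg x, abs_nonneg y])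
  obtain ⟨C₂, hC₂, h₂⟩ := D.exists_norm_sineProd_le
  refine ⟨C₂ * (C₁ * 2 ^ N), N, by positivity, fun s hx hy ht => ?_⟩
  have h3 := h₁ (conj s) (by rw [conj_re]; linarith [neg_abs_le x, abs_nonneg y])
    (by rw [conj_re]; linarith [le_abs_self y, abs_nonneg x])
  rw [conj_im, abs_neg, norm_mul] at h3
  have h4 : 1 ≤ ‖(conj s - 1) ^ m‖ := by
    rw [norm_pow]
    refine one_le_pow₀ (ht.trans ?_)
    have := abs_im_le_norm (conj s - 1)
    simpa using this
  have h5 : ‖conjFn F s‖ ≤ C₁ * 2 ^ N * |s.im| ^ N := by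
    rw [norm_conjFn]
    calc _ ≤ ‖(conj s - 1) ^ m‖ * ‖F (conj s)‖ := le_mul_of_one_le_left (norm_nonneg _) h4
      _ ≤ C₁ * (1 + |s.im|) ^ N := h3
      _ ≤ C₁ * (2 * |s.im|) ^ N := by gcongr; linarith
      _ = _ := by rw [mul_pow]; ring
  rw [norm_mul]
  calc _ ≤ (C₂ * Real.exp (Real.pi / 2 * D.degree * |s.im|)) * (C₁ * 2 ^ N * |s.im| ^ N) := by
        gcongr; exact h₂ s
    _ = _ := by ring

end IsExtendedSelberg

/-! ### The argument bound and Taylor's formula for complex powers -/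

/-- The sum of 1 and ρ e^(iφ) stays in the sector they span. If its argument exceeded φ, the
identity |v| sin(arg v - φ) = -sin φ ≤ 0 would fail. -/
theorem arg_one_add_exp_mem {φ ρ : ℝ} (h0 : 0 ≤ φ) (hπ : φ ≤ Real.pi) (hρ : 0 ≤ ρ) :
    0 ≤ arg (1 + exp (φ * I) * ρ) ∧ arg (1 + exp (φ * I) * ρ) ≤ φ := by
  set v : ℂ := 1 + exp (φ * I) * ρ with hv
  have hvre : v.re = 1 + Real.cos φ * ρ := by
    rw [hv]; simp [exp_ofReal_mul_I_re]
  have hvim : v.im = Real.sin φ * ρ := by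
    rw [hv]; simp [exp_ofReal_mul_I_im]
  have hsin : 0 ≤ Real.sin φ := Real.sin_nonneg_of_nonneg_of_le_pi h0 hπ
  have hnn : 0 ≤ arg v := by
    rw [arg_nonneg_iff, hvim]; positivity
  refine ⟨hnn, ?_⟩
  by_contra! hlt
  have hle := arg_le_pi v
  have hv0 : v ≠ 0 := by
    rintro h
    rw [h, arg_zero] at hlt
    linarith
  have hnorm : 0 < ‖v‖ := norm_pos_iff.mpr hv0
  have key : ‖v‖ * Real.sin (arg v - φ) = -Real.sin φ := by
    rw [Real.sin_sub, mul_sub, ← mul_assoc, ← mul_assoc, norm_mul_sin_arg, norm_mul_cos_arg,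
      hvre, hvim]
    ring
  -- φ = 0 is treated apart, since arg v - φ could then equal π, where the sine vanishes without
  -- contradiction.
  rcases eq_or_lt_of_le h0 with h | h
  · have hz : v = ((1 + ρ : ℝ) : ℂ) := by rw [hv, ← h]; simp
    rw [hz, arg_ofReal_of_nonneg (by positivity)] at hlt
    linarith
  · have := Real.sin_pos_of_pos_of_lt_pi (show 0 < arg v - φ by linarith) (by linarith)
    nlinarith

/-- The generalized binomial coefficient. -/
noncomputable def binom (β : ℂ) (k : ℕ) : ℂ := (∏ i ∈ range k, (β - i)) / k.factorial

/-- This identity says that differentiating the binomial series of exponent β gives β times that of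
exponent β - 1. -/
theorem binom_succ_mul (β : ℂ) (k : ℕ) :
    binom β (k + 1) * (k + 1) = β * binom (β - 1) k := by
  have h1 : ((k : ℂ) + 1) ≠ 0 := by exact_mod_cast k.succ_ne_zero
  have h2 : (k.factorial : ℂ) ≠ 0 := by exact_mod_cast k.factorial_ne_zero
  have h3 : ∏ i ∈ range k, (β - ((i + 1 : ℕ) : ℂ)) = ∏ i ∈ range k, (β - 1 - i) :=
    Finset.prod_congr rfl fun i _ => by push_cast; ring
  rw [binom, binom, Finset.prod_range_succ', h3, Nat.factorial_succ]
  push_cast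
  field_simp
  ring

theorem norm_binom_le (β : ℂ) (k : ℕ) : ‖binom β k‖ ≤ (‖β‖ + k) ^ k := by
  rw [binom, norm_div, norm_prod]
  refine (div_le_self (by positivity) ?_).trans ?_
  · rw [norm_natCast]; exact_mod_cast Nat.one_le_iff_ne_zero.mpr k.factorial_ne_zero
  · calc _ ≤ ∏ _i ∈ range k, (‖β‖ + k) := by
          refine Finset.prod_le_prod (fun _ _ => norm_nonneg _) fun i hi => ?_
          refine (norm_sub_le _ _).trans ?_
          rw [norm_natCast]
          gcongr
          exact (Finset.mem_range.mp hi).le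
      _ = _ := by simp

theorem differentiable_binom (k : ℕ) : Differentiable ℂ fun β => binom β k := by
  unfold binom
  fun_prop

/-- Taylor expansion of `(1 + z) ^ β` with a remainder estimate. -/
theorem norm_one_add_cpow_sub_sum_le (K : ℕ) : ∀ (β z : ℂ) (B : ℝ), ‖z‖ < 1 →
    (∀ u ∈ Set.Icc (0 : ℝ) 1, ‖(1 + u * z) ^ (β - K)‖ ≤ B) →
    ‖(1 + z) ^ β - ∑ k ∈ range K, binom β k * z ^ k‖ ≤
      ‖∏ i ∈ range K, (β - i)‖ * ‖z‖ ^ K * B := by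
  induction K with
  | zero =>
    intro β z B _ hB
    simpa using hB 1 (by simp)
  | succ K ih =>
    intro β z B hz hB
    have hslit : ∀ u ∈ Set.Icc (0 : ℝ) 1, (1 + u * z : ℂ) ∈ slitPlane := fun u hu => by
      refine mem_slitPlane_of_norm_lt_one ?_
      rw [norm_mul, norm_real, Real.norm_eq_abs, abs_of_nonneg hu.1]
      nlinarith [hu.2, norm_nonneg z]
    -- Along the segment from 0 to z, the derivative of the remainder for (β, K + 1) is βz times the
    -- remainder for (β - 1, K). The mean value inequality then closes the induction.
    have hderiv : ∀ u ∈ Set.Icc (0 : ℝ) 1, HasDerivWithinAt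
        (fun u : ℝ => (1 + u * z : ℂ) ^ β - ∑ k ∈ range (K + 1), binom β k * (u * z) ^ k)
        (β * z * ((1 + u * z) ^ (β - 1) - ∑ k ∈ range K, binom (β - 1) k * (u * z) ^ k))
        (Set.Icc 0 1) u := by
      intro u hu
      have h0 : HasDerivAt (fun u : ℝ => (u : ℂ) * z) z u := by
        simpa using (Complex.ofRealCLM.hasDerivAt (x := u)).mul_const z
      have h1 : HasDerivAt (fun u : ℝ => (1 + u * z : ℂ) ^ β)
          (β * (1 + u * z) ^ (β - 1) * z) u := by
        have hg : HasDerivAt (fun v : ℂ => (1 + v) ^ β) (β * (1 + u * z) ^ (β - 1) * 1) (u * z) :=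
          ((hasDerivAt_id _).const_add 1).cpow_const (hslit u hu)
        rw [mul_one] at hg
        exact hg.comp u h0
      have h2 : HasDerivAt (fun u : ℝ => ∑ k ∈ range K, binom β (k + 1) * ((u : ℂ) * z) ^ (k + 1))
          (∑ k ∈ range K, β * binom (β - 1) k * ((u : ℂ) * z) ^ k * z) u := by
        refine HasDerivAt.fun_sum fun k _ => ?_
        have := (h0.pow (k + 1)).const_mul (binom β (k + 1))
        refine this.congr_deriv ?_
        rw [← binom_succ_mul]
        push_cast
        ring
      have h3 := (h1.sub (h2.add_const (binom β 0))).hasDerivWithinAt (s := Set.Icc (0 : ℝ) 1)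
      have e : (fun u : ℝ => (1 + u * z : ℂ) ^ β - ∑ k ∈ range (K + 1), binom β k * (u * z) ^ k) =
          ((fun u : ℝ => (1 + u * z : ℂ) ^ β) - fun u : ℝ =>
            (∑ k ∈ range K, binom β (k + 1) * ((u : ℂ) * z) ^ (k + 1)) + binom β 0) := by
        funext u
        simp [Finset.sum_range_succ']
      rw [e]
      refine h3.congr_deriv ?_
      rw [mul_sub, Finset.mul_sum]
      congr 1
      · ring
      · exact Finset.sum_congr rfl fun k _ => by ring
    have hbound : ∀ u ∈ Set.Ico (0 : ℝ) 1,
        ‖β * z * ((1 + u * z) ^ (β - 1) - ∑ k ∈ range K, binom (β - 1) k * (u * z) ^ k)‖ ≤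
          ‖∏ i ∈ range (K + 1), (β - i)‖ * ‖z‖ ^ (K + 1) * B := by
      intro u hu
      have hn : ‖(u : ℂ) * z‖ ≤ ‖z‖ := by
        rw [norm_mul, norm_real, Real.norm_eq_abs, abs_of_nonneg hu.1]
        exact mul_le_of_le_one_left (norm_nonneg _) hu.2.le
      have hB0 : 0 ≤ B := (norm_nonneg _).trans (hB 0 (by simp))
      have h := ih (β - 1) (u * z) B (hn.trans_lt hz) fun v hv => by
        have := hB (v * u) ⟨mul_nonneg hv.1 hu.1, mul_le_one₀ hv.2 hu.1 hu.2.le⟩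
        convert this using 3
        · push_cast; ring
        · push_cast; ring
      have h3 : ∏ i ∈ range (K + 1), (β - i) = β * ∏ i ∈ range K, (β - 1 - i) := by
        rw [Finset.prod_range_succ', mul_comm]
        congr 1
        · simp
        · exact Finset.prod_congr rfl fun i _ => by push_cast; ring
      rw [norm_mul, norm_mul, h3, norm_mul]
      calc _ ≤ ‖β‖ * ‖z‖ * (‖∏ i ∈ range K, (β - 1 - i)‖ * ‖z‖ ^ K * B) := by
            gcongr
            refine h.trans ?_
            gcongr
        _ = _ := by ring
    have := norm_image_sub_le_of_norm_deriv_le_segment_01' hderiv hbound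
    simpa [Finset.sum_range_succ', binom] using this

/-! ### Uniform bounds for the terms of the inner series -/

namespace GammaData

variable (D : GammaData)

theorem abs_le_half_of_mem_freqs {w : ℝ} (hd : 0 < D.degree) (hw : w ∈ D.freqs) :
    -(1 / 2) ≤ w ∧ w ≤ 1 / 2 := by
  rw [freqs, Finset.mem_image] at hw
  obtain ⟨ε, -, rfl⟩ := hw
  have h : |∑ j, ((ε j : ℤ) : ℝ) * D.lam j| ≤ D.degree / 2 := by
    refine (Finset.abs_sum_le_sum_abs _ _).trans (le_of_eq ?_)
    rw [degree, mul_div_cancel_left₀ _ two_ne_zero]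
    refine Finset.sum_congr rfl fun j _ => ?_
    rw [abs_mul, abs_of_pos (D.lam_pos j)]
    rcases Int.units_eq_one_or (ε j) with h | h <;> simp [h]
  rw [abs_le] at h
  rw [signFreq, le_div_iff₀ hd, div_le_iff₀ hd]
  constructor <;> linarith [h.1, h.2]

/-- The quantity `e^(i π (1/2 - w)) (n_α / n)^(1/d)`. -/
noncomputable def shift (α w : ℝ) (n : ℕ) : ℂ :=
  exp (I * Real.pi * (1 / 2 - w)) * (((D.nAlpha α / n) ^ (1 / D.degree) : ℝ) : ℂ)

/-- The exponent `d (1 - s - s_ℓ^*)`. -/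
noncomputable def expo (l : ℕ) (s : ℂ) : ℂ := (D.degree : ℂ) * (1 - s - D.sStar l)

/-- The factor `e^(i π d w (1 - s))`. -/
noncomputable def freqExp (w : ℝ) (s : ℂ) : ℂ := exp (I * Real.pi * D.degree * w * (1 - s))

/-- The power occurring in `innerTerm`. -/
noncomputable def powTerm (l : ℕ) (α w : ℝ) (s : ℂ) (n : ℕ) : ℂ :=
  if n = 0 ∨ (w = -(1 / 2) ∧ (n : ℝ) = D.nAlpha α) then 0
  else (1 + D.shift α w n) ^ D.expo l s

theorem innerTerm_eq (a : ℕ → ℂ) (l : ℕ) (α w : ℝ) (s : ℂ) (n : ℕ) :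
    D.innerTerm a l α w s n = LSeries.term (fun n => conj (a n)) s n * D.powTerm l α w s n := by
  rw [innerTerm, powTerm, LSeries.term]
  by_cases h0 : n = 0
  · simp [h0]
  · by_cases h1 : n = 0 ∨ (w = -(1 / 2) ∧ (n : ℝ) = D.nAlpha α)
    · rw [if_pos h1, if_pos h1, mul_zero]
    · rw [if_neg h1, if_neg h1, if_neg h0]; rfl

theorem norm_freqExp (w : ℝ) (s : ℂ) :
    ‖D.freqExp w s‖ = Real.exp (Real.pi * D.degree * w * s.im) := by
  rw [freqExp, norm_exp]
  congr 1
  simp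

theorem norm_freqExp_le (hd : 0 ≤ D.degree) {w : ℝ} (h1 : -(1 / 2) ≤ w) (h2 : w ≤ 1 / 2) (s : ℂ) :
    ‖D.freqExp w s‖ ≤ Real.exp (Real.pi / 2 * D.degree * |s.im|) := by
  rw [norm_freqExp]
  have h : w * s.im ≤ 1 / 2 * |s.im| := by
    refine (le_abs_self _).trans ?_
    rw [abs_mul]
    gcongr
    exact abs_le.mpr ⟨h1, h2⟩
  have h3 : 0 ≤ Real.pi * D.degree := mul_nonneg Real.pi_pos.le hd
  rw [Real.exp_le_exp]
  nlinarith

theorem expo_im (l : ℕ) (s : ℂ) : (D.expo l s).im = -D.degree * (s.im - D.theta) := by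
  rw [expo, im_ofReal_mul, sub_im, sub_im, sStar, sub_im, ofReal_im]
  simp
  ring

theorem expo_re (l : ℕ) (s : ℂ) :
    (D.expo l s).re = D.degree * (1 - s.re - (D.sStar l).re) := by
  simp [expo]

/-- The exponential part has exponent d(πwt + arg(v)(t - θ)). For t ≥ 0 the bound arg v ≤ π(1/2 - w)
gives at most πdt/2 from the t-terms; for t ≤ 0 arg v ≥ 0 and w ≥ -1/2 suffice. The θ-term is a
constant. -/
theorem norm_freqExp_mul_cpow_le (hd : 0 ≤ D.degree) {w : ℝ} (h1 : -(1 / 2) ≤ w) (h2 : w ≤ 1 / 2)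
    (l : ℕ) (s : ℂ) (k : ℕ) {ρ : ℝ} (hρ : 0 ≤ ρ)
    (hv : 1 + exp (I * Real.pi * (1 / 2 - w)) * ρ ≠ 0) :
    ‖D.freqExp w s * (1 + exp (I * Real.pi * (1 / 2 - w)) * ρ) ^ (D.expo l s - k)‖ ≤
      ‖1 + exp (I * Real.pi * (1 / 2 - w)) * ρ‖ ^ ((D.expo l s).re - k) *
        (Real.exp (Real.pi * D.degree * |D.theta|) *
          Real.exp (Real.pi / 2 * D.degree * |s.im|)) := by
  have hφ0 : 0 ≤ Real.pi * (1 / 2 - w) := mul_nonneg Real.pi_pos.le (by linarith)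
  have hφπ : Real.pi * (1 / 2 - w) ≤ Real.pi := by nlinarith [Real.pi_pos]
  have harg := arg_one_add_exp_mem hφ0 hφπ hρ
  have e : ((Real.pi * (1 / 2 - w) : ℝ) : ℂ) * I = I * Real.pi * (1 / 2 - w) := by
    push_cast; ring
  rw [e] at harg
  set v := 1 + exp (I * Real.pi * (1 / 2 - w)) * ρ
  have him : (D.expo l s - k).im = -D.degree * (s.im - D.theta) := by
    rw [sub_im, expo_im]; simp
  have hre : (D.expo l s - k).re = (D.expo l s).re - k := by simp
  rw [norm_mul, norm_freqExp, norm_cpow_of_ne_zero hv, him, hre, div_eq_mul_inv, ← Real.exp_neg,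
    mul_left_comm, ← Real.exp_add, ← Real.exp_add]
  refine mul_le_mul_of_nonneg_left (Real.exp_le_exp.mpr ?_) (by positivity)
  obtain ⟨ha0, ha1⟩ := harg
  have hA : arg v * (-D.theta) ≤ Real.pi * |D.theta| := by
    have := neg_abs_le D.theta
    have := arg_le_pi v
    nlinarith [abs_nonneg D.theta]
  have hT : Real.pi * w * s.im + arg v * s.im ≤ Real.pi / 2 * |s.im| := by
    rcases le_total 0 s.im with ht | ht
    · rw [abs_of_nonneg ht]; nlinarith
    · rw [abs_of_nonpos ht]
      have : arg v * s.im ≤ 0 := mul_nonpos_of_nonneg_of_nonpos ha0 ht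
      nlinarith [mul_nonneg Real.pi_pos.le (mul_nonneg (show 0 ≤ w + 1 / 2 by linarith)
        (neg_nonneg.mpr ht))]
  linear_combination mul_le_mul_of_nonneg_left (add_le_add hT hA) hd

end GammaData

theorem rpow_le_max_inv_rpow {v r R : ℝ} (hv : 0 < v) (hr : |r| ≤ R) :
    v ^ r ≤ (max v v⁻¹) ^ R := by
  have h1 : 1 ≤ max v v⁻¹ := by
    rcases le_total 1 v with h | h
    · exact le_max_of_le_left h
    · exact le_max_of_le_right ((one_le_inv₀ hv).mpr h)
  rcases le_total 0 r with h | h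
  · calc v ^ r ≤ (max v v⁻¹) ^ r := Real.rpow_le_rpow hv.le (le_max_left _ _) h
      _ ≤ _ := Real.rpow_le_rpow_of_exponent_le h1 ((le_abs_self r).trans hr)
  · calc v ^ r = (v⁻¹) ^ (-r) := by rw [Real.inv_rpow hv.le, Real.rpow_neg hv.le, inv_inv]
      _ ≤ (max v v⁻¹) ^ (-r) :=
        Real.rpow_le_rpow (by positivity) (le_max_right _ _) (neg_nonneg.mpr h)
      _ ≤ _ := Real.rpow_le_rpow_of_exponent_le h1 ((neg_le_abs r).trans hr)

theorem norm_prod_sub_le (β : ℂ) (K : ℕ) :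
    ‖∏ i ∈ range K, (β - i)‖ ≤ K.factorial * (‖β‖ + K) ^ K := by
  have h : ∏ i ∈ range K, (β - i) = K.factorial * binom β K := by
    rw [binom, mul_div_cancel₀]
    exact_mod_cast K.factorial_ne_zero
  rw [h, norm_mul, norm_natCast]
  gcongr
  exact norm_binom_le β K

namespace GammaData

variable (D : GammaData)

theorem exists_expo_bounds (hd : 0 < D.degree) (l K : ℕ) (x y : ℝ) :
    ∃ R : ℝ, 1 ≤ R ∧ ∀ s : ℂ, x ≤ s.re → s.re ≤ y →
      ‖D.expo l s‖ + K ≤ R * (1 + |s.im|) ∧ |(D.expo l s).re - K| ≤ R ∧ |(D.expo l s).re| ≤ R := by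
  set S := 1 + (|x| + |y|) + ‖D.sStar l‖ with hS
  refine ⟨D.degree * S + D.degree + K + 1, by
    have : 0 ≤ D.degree * S := by positivity
    have := K.cast_nonneg (α := ℝ)
    linarith, fun s hx hy => ?_⟩
  have hre : |s.re| ≤ |x| + |y| := by
    rw [abs_le]
    constructor
    · linarith [neg_abs_le x, abs_nonneg y]
    · linarith [le_abs_self y, abs_nonneg x]
  have h1 : ‖D.expo l s‖ ≤ D.degree * (S + |s.im|) := by
    rw [expo, norm_mul, norm_real, Real.norm_eq_abs, abs_of_pos hd]
    gcongr
    refine (norm_sub_le _ _).trans ?_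
    have h2 := norm_sub_le 1 s
    rw [norm_one] at h2
    have h3 := norm_le_abs_re_add_abs_im s
    linarith
  have h2 : |(D.expo l s).re| ≤ D.degree * S := by
    rw [expo_re, abs_mul, abs_of_pos hd]
    gcongr
    refine (abs_sub _ _).trans ?_
    have h3 := abs_sub 1 s.re
    rw [abs_one] at h3
    have h4 := abs_re_le_norm (D.sStar l)
    linarith
  have hK := K.cast_nonneg (α := ℝ)
  have hDS : 0 ≤ D.degree * S := by positivity
  refine ⟨?_, ?_, by linarith⟩
  · nlinarith [mul_nonneg hDS (abs_nonneg s.im), abs_nonneg s.im, mul_nonneg hK (abs_nonneg s.im)]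
  · refine (abs_sub _ _).trans ?_
    rw [abs_of_nonneg hK]
    linarith

theorem conductor_pos : 0 < D.conductor := by
  unfold conductor
  have h1 : (0 : ℝ) < 2 * Real.pi := by positivity
  have h2 := D.Q_pos
  have h3 : 0 < ∏ j, D.lam j ^ (2 * D.lam j) :=
    Finset.prod_pos fun j _ => Real.rpow_pos_of_pos (D.lam_pos j) _
  positivity

theorem nAlpha_pos (hd : 0 < D.degree) {α : ℝ} (hα : 0 < α) : 0 < D.nAlpha α := by
  unfold nAlpha
  have := D.conductor_pos
  positivity

theorem norm_shift (hd : 0 < D.degree) {α : ℝ} (hα : 0 < α) (w : ℝ) (n : ℕ) :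
    ‖D.shift α w n‖ = (D.nAlpha α / n) ^ (1 / D.degree) := by
  have := D.nAlpha_pos hd hα
  have e : I * Real.pi * (1 / 2 - w) = ((Real.pi * (1 / 2 - w) : ℝ) : ℂ) * I := by push_cast; ring
  rw [shift, norm_mul, norm_real, e, norm_exp_ofReal_mul_I, one_mul, Real.norm_eq_abs, abs_of_nonneg]
  positivity

theorem norm_shift_pow (hd : 0 < D.degree) {α : ℝ} (hα : 0 < α) (w : ℝ) (n K : ℕ) :
    ‖D.shift α w n‖ ^ K =
      D.nAlpha α ^ (K / D.degree) * (n : ℝ) ^ (-(K / D.degree)) := by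
  have := D.nAlpha_pos hd hα
  rw [D.norm_shift hd hα, ← Real.rpow_natCast, ← Real.rpow_mul (by positivity),
    Real.div_rpow this.le n.cast_nonneg, Real.rpow_neg n.cast_nonneg, div_eq_mul_inv, one_div,
    inv_mul_eq_div]

/-- The prefactor times the power, for a parameter `u ∈ [0, 1]` in front of the shift. -/
theorem norm_freqExp_mul_cpow_shift_le (hd : 0 < D.degree) {α : ℝ} (hα : 0 < α) {w : ℝ}
    (h1 : -(1 / 2) ≤ w) (h2 : w ≤ 1 / 2) (l : ℕ) (s : ℂ) (k n : ℕ) {u : ℝ} (hu : 0 ≤ u)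
    {R : ℝ} (hR : |(D.expo l s).re - k| ≤ R) (hv : 1 + u * D.shift α w n ≠ 0) :
    ‖D.freqExp w s * (1 + u * D.shift α w n) ^ (D.expo l s - k)‖ ≤
      (max ‖1 + u * D.shift α w n‖ ‖1 + u * D.shift α w n‖⁻¹) ^ R *
        (Real.exp (Real.pi * D.degree * |D.theta|) *
          Real.exp (Real.pi / 2 * D.degree * |s.im|)) := by
  have := D.nAlpha_pos hd hα
  have e : 1 + u * D.shift α w n = 1 + exp (I * Real.pi * (1 / 2 - w)) *
      ((u * (D.nAlpha α / n) ^ (1 / D.degree) : ℝ) : ℂ) := by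
    rw [shift]; push_cast; ring
  rw [e] at hv ⊢
  refine (D.norm_freqExp_mul_cpow_le hd.le h1 h2 l s k (by positivity) hv).trans ?_
  gcongr
  exact rpow_le_max_inv_rpow (norm_pos_iff.mpr hv) hR

theorem exists_norm_powTerm_sub_le_large (hd : 0 < D.degree) {α : ℝ} (hα : 0 < α) {w : ℝ}
    (h1 : -(1 / 2) ≤ w) (h2 : w ≤ 1 / 2) (l K : ℕ) (x y : ℝ) :
    ∃ (C : ℝ) (N : ℕ), 0 ≤ C ∧ ∀ n : ℕ, N ≤ n → n ≠ 0 → ∀ s : ℂ, x ≤ s.re → s.re ≤ y →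
      ‖D.freqExp w s * (D.powTerm l α w s n -
        ∑ k ∈ range K, binom (D.expo l s) k * D.shift α w n ^ k)‖ ≤
      C * (1 + |s.im|) ^ K * Real.exp (Real.pi / 2 * D.degree * |s.im|) *
        (n : ℝ) ^ (-(K / D.degree)) := by
  obtain ⟨R, hR1, hR⟩ := D.exists_expo_bounds hd l K x y
  have hpos := D.nAlpha_pos hd hα
  -- Beyond 2^d n_α the shift has modulus at most 1/2, and n ≠ n_α, so no term is omitted.
  obtain ⟨N, hN⟩ := exists_nat_gt ((2 : ℝ) ^ D.degree * D.nAlpha α)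
  refine ⟨K.factorial * R ^ K * D.nAlpha α ^ (K / D.degree) *
    ((2 : ℝ) ^ R * Real.exp (Real.pi * D.degree * |D.theta|)), N, by positivity,
    fun n hn hn0 s hx hy => ?_⟩
  have hn1 : (0 : ℝ) < n := by exact_mod_cast Nat.pos_of_ne_zero hn0
  have hnN : (2 : ℝ) ^ D.degree * D.nAlpha α < n := hN.trans_le (by exact_mod_cast hn)
  have hz : ‖D.shift α w n‖ ≤ 1 / 2 := by
    rw [D.norm_shift hd hα]
    have h : D.nAlpha α / n ≤ (1 / 2 : ℝ) ^ D.degree := by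
      rw [div_le_iff₀ hn1, Real.div_rpow zero_le_one zero_le_two, Real.one_rpow,
        div_mul_eq_mul_div, one_mul, le_div_iff₀ (by positivity)]
      linarith
    calc _ ≤ ((1 / 2 : ℝ) ^ D.degree) ^ (1 / D.degree) :=
          Real.rpow_le_rpow (by positivity) h (by positivity)
      _ = 1 / 2 := by
          rw [← Real.rpow_mul (by norm_num), mul_one_div_cancel hd.ne', Real.rpow_one]
  have hpow : D.powTerm l α w s n = (1 + D.shift α w n) ^ D.expo l s := by
    rw [powTerm, if_neg]
    rintro (h | ⟨-, h⟩)
    · exact hn0 h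
    · rw [h] at hnN
      have : (1 : ℝ) ≤ 2 ^ D.degree := Real.one_le_rpow one_le_two hd.le
      nlinarith
  have hf : D.freqExp w s ≠ 0 := exp_ne_zero _
  have hfn : 0 < ‖D.freqExp w s‖ := norm_pos_iff.mpr hf
  set E := (2 : ℝ) ^ R * (Real.exp (Real.pi * D.degree * |D.theta|) *
    Real.exp (Real.pi / 2 * D.degree * |s.im|)) with hE
  -- Only the product of the power with the frequency factor has the right growth, so the bound on
  -- the power is E divided by the modulus of that factor, which is restored at the end.
  have hT := norm_one_add_cpow_sub_sum_le K (D.expo l s) (D.shift α w n) (E / ‖D.freqExp w s‖)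
    (by linarith) fun u hu => by
      have hu' : ‖(u : ℂ) * D.shift α w n‖ ≤ 1 / 2 := by
        rw [norm_mul, norm_real, Real.norm_eq_abs, abs_of_nonneg hu.1]
        nlinarith [hu.2, norm_nonneg (D.shift α w n)]
      have hlow : 1 / 2 ≤ ‖1 + (u : ℂ) * D.shift α w n‖ := by
        have := norm_sub_norm_le (1 : ℂ) (-((u : ℂ) * D.shift α w n))
        rw [norm_one, norm_neg, sub_neg_eq_add] at this
        linarith
      have hupp : ‖1 + (u : ℂ) * D.shift α w n‖ ≤ 2 := by
        refine (norm_add_le _ _).trans ?_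
        rw [norm_one]; linarith
      rw [le_div_iff₀ hfn, mul_comm, ← norm_mul]
      refine (D.norm_freqExp_mul_cpow_shift_le hd hα h1 h2 l s K n hu.1 (hR s hx hy).2.1 ?_).trans ?_
      · intro h; rw [h, norm_zero] at hlow; norm_num at hlow
      · rw [hE]
        gcongr
        refine max_le hupp ?_
        rw [inv_le_comm₀ (by linarith) two_pos]
        linarith
  have hP : ‖∏ i ∈ range K, (D.expo l s - i)‖ ≤ K.factorial * (R * (1 + |s.im|)) ^ K := by
    refine (norm_prod_sub_le _ _).trans ?_
    gcongr
    exact (hR s hx hy).1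
  rw [norm_mul, hpow]
  calc _ ≤ ‖D.freqExp w s‖ * (‖∏ i ∈ range K, (D.expo l s - i)‖ * ‖D.shift α w n‖ ^ K *
        (E / ‖D.freqExp w s‖)) := by gcongr
    _ = ‖∏ i ∈ range K, (D.expo l s - i)‖ * ‖D.shift α w n‖ ^ K * E := by field_simp
    _ ≤ (K.factorial * (R * (1 + |s.im|)) ^ K) * ‖D.shift α w n‖ ^ K * E := by gcongr
    _ = _ := by rw [D.norm_shift_pow hd hα, hE, mul_pow]; ring

/-- For one fixed n no cancellation is needed: power and truncated expansion are bounded separately,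
and n^(K/d) goes into the constant. This serves the finitely many n where the shift is not small. -/
theorem exists_norm_powTerm_sub_le_single (hd : 0 < D.degree) {α : ℝ} (hα : 0 < α) {w : ℝ}
    (h1 : -(1 / 2) ≤ w) (h2 : w ≤ 1 / 2) (l K : ℕ) (x y : ℝ) (n : ℕ) :
    ∃ C : ℝ, 0 ≤ C ∧ (n ≠ 0 → ∀ s : ℂ, x ≤ s.re → s.re ≤ y →
      ‖D.freqExp w s * (D.powTerm l α w s n -
        ∑ k ∈ range K, binom (D.expo l s) k * D.shift α w n ^ k)‖ ≤
      C * (1 + |s.im|) ^ K * Real.exp (Real.pi / 2 * D.degree * |s.im|) *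
        (n : ℝ) ^ (-(K / D.degree))) := by
  obtain ⟨R, hR1, hR⟩ := D.exists_expo_bounds hd l K x y
  set A := 1 + (max ‖1 + D.shift α w n‖ ‖1 + D.shift α w n‖⁻¹) ^ R *
    Real.exp (Real.pi * D.degree * |D.theta|) with hA
  have hA0 : 1 ≤ A := by
    rw [hA, le_add_iff_nonneg_right]; positivity
  set B := ∑ k ∈ range K, R ^ K * ‖D.shift α w n‖ ^ k with hB
  have hB0 : 0 ≤ B := by rw [hB]; positivity
  refine ⟨(A + B) * (n : ℝ) ^ (K / D.degree), by positivity, fun hn0 s hx hy => ?_⟩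
  have hn1 : (0 : ℝ) < n := by exact_mod_cast Nat.pos_of_ne_zero hn0
  set E := Real.exp (Real.pi / 2 * D.degree * |s.im|) with hE
  have hE0 : 0 < E := Real.exp_pos _
  have hF : ‖D.freqExp w s‖ ≤ E := D.norm_freqExp_le hd.le h1 h2 s
  have hpow : ‖D.freqExp w s * D.powTerm l α w s n‖ ≤ A * E := by
    have hAE : E ≤ A * E := le_mul_of_one_le_left hE0.le hA0
    rw [powTerm]
    split_ifs with h
    · rw [mul_zero, norm_zero]; positivity
    · by_cases hv : 1 + D.shift α w n = 0
      · rw [hv, norm_mul]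
        refine le_trans ?_ hAE
        by_cases he : D.expo l s = 0
        · simpa [he] using hF
        · rw [zero_cpow he, norm_zero, mul_zero]; exact hE0.le
      · have := D.norm_freqExp_mul_cpow_shift_le hd hα h1 h2 l s 0 n (u := 1) zero_le_one
          (R := R) (by simpa using (hR s hx hy).2.2) (by simpa using hv)
        simp only [ofReal_one, one_mul, Nat.cast_zero, sub_zero] at this
        refine this.trans ?_
        rw [hA, add_mul, ← mul_assoc]
        linarith
  have hT1 : 1 ≤ (1 + |s.im|) ^ K := one_le_pow₀ (by linarith [abs_nonneg s.im])
  have hsum : ‖∑ k ∈ range K, binom (D.expo l s) k * D.shift α w n ^ k‖ ≤ B * (1 + |s.im|) ^ K := by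
    rw [hB, Finset.sum_mul]
    refine (norm_sum_le _ _).trans (Finset.sum_le_sum fun k hk => ?_)
    have hkK := (Finset.mem_range.mp hk).le
    rw [norm_mul, norm_pow]
    have hb : ‖binom (D.expo l s) k‖ ≤ R ^ K * (1 + |s.im|) ^ K := by
      rw [← mul_pow]
      have hk' : ‖D.expo l s‖ + k ≤ R * (1 + |s.im|) := by
        have := (hR s hx hy).1
        have : (k : ℝ) ≤ K := by exact_mod_cast hkK
        linarith
      calc _ ≤ (‖D.expo l s‖ + k) ^ k := norm_binom_le _ _
        _ ≤ (R * (1 + |s.im|)) ^ k := by gcongr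
        _ ≤ _ := pow_le_pow_right₀ (one_le_mul_of_one_le_of_one_le hR1
          (by linarith [abs_nonneg s.im])) hkK
    calc _ ≤ (R ^ K * (1 + |s.im|) ^ K) * ‖D.shift α w n‖ ^ k := by gcongr
      _ = _ := by ring
  have hnn : (n : ℝ) ^ (K / D.degree) * (n : ℝ) ^ (-(K / D.degree)) = 1 := by
    rw [← Real.rpow_add hn1]; simp
  rw [mul_sub]
  refine (norm_sub_le _ _).trans ?_
  rw [norm_mul _ (∑ k ∈ range K, _)]
  calc _ ≤ A * E + E * (B * (1 + |s.im|) ^ K) := by gcongr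
    _ ≤ A * E * (1 + |s.im|) ^ K + E * (B * (1 + |s.im|) ^ K) := by
        have := le_mul_of_one_le_right (show 0 ≤ A * E by positivity) hT1
        linarith
    _ = (A + B) * ((n : ℝ) ^ (K / D.degree) * (n : ℝ) ^ (-(K / D.degree))) *
        (1 + |s.im|) ^ K * E := by rw [hnn]; ring
    _ = _ := by ring

theorem exists_norm_powTerm_sub_le (hd : 0 < D.degree) {α : ℝ} (hα : 0 < α) {w : ℝ}
    (h1 : -(1 / 2) ≤ w) (h2 : w ≤ 1 / 2) (l K : ℕ) (x y : ℝ) :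
    ∃ C : ℝ, 0 ≤ C ∧ ∀ n : ℕ, n ≠ 0 → ∀ s : ℂ, x ≤ s.re → s.re ≤ y →
      ‖D.freqExp w s * (D.powTerm l α w s n -
        ∑ k ∈ range K, binom (D.expo l s) k * D.shift α w n ^ k)‖ ≤
      C * (1 + |s.im|) ^ K * Real.exp (Real.pi / 2 * D.degree * |s.im|) *
        (n : ℝ) ^ (-(K / D.degree)) := by
  obtain ⟨C, N, hC, H⟩ := D.exists_norm_powTerm_sub_le_large hd hα h1 h2 l K x y
  choose c hc Hc using fun n => D.exists_norm_powTerm_sub_le_single hd hα h1 h2 l K x y n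
  have hs : 0 ≤ ∑ n ∈ range N, c n := Finset.sum_nonneg fun n _ => hc n
  refine ⟨C + ∑ n ∈ range N, c n, by positivity, fun n hn s hx hy => ?_⟩
  rcases le_or_gt N n with h | h
  · refine (H n h hn s hx hy).trans ?_
    gcongr
    linarith
  · refine (Hc n hn s hx hy).trans ?_
    gcongr
    have := Finset.single_le_sum (fun i _ => hc i) (Finset.mem_range.mpr h)
    linarith

end GammaData

/-! ### Analytic continuation of F̄_ℓ -/

theorem term_conj (a : ℕ → ℂ) (s : ℂ) (n : ℕ) :
    LSeries.term (fun n => conj (a n)) s n = conj (LSeries.term a (conj s) n) := by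
  rw [LSeries.term, LSeries.term]
  split_ifs with h
  · simp
  · rw [map_div₀, cpow_conj _ _ (by rw [natCast_arg]; exact Real.pi_pos.ne), conj_natCast, conj_conj]

theorem term_add_right (a : ℕ → ℂ) (s z : ℂ) (n : ℕ) :
    LSeries.term a (s + z) n = LSeries.term a s n * (n : ℂ) ^ (-z) := by
  rw [LSeries.term, LSeries.term]
  split_ifs with h
  · simp
  · rw [cpow_add _ _ (by exact_mod_cast h), cpow_neg, ← div_div, div_eq_mul_inv (_ / _)]

/-- Holomorphic functions on increasing half planes which agree on a common half plane patch
together to an entire function. -/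
theorem exists_entire_of_halfPlanes {g : ℕ → ℂ → ℂ} {f : ℂ → ℂ} {c : ℕ → ℝ} {c₀ : ℝ}
    (hc : ∀ K, c K ≤ c₀) (hlim : ∀ r : ℝ, ∃ K, c K < r)
    (hg : ∀ K, DifferentiableOn ℂ (g K) {s | c K < s.re})
    (hf : ∀ K s, c₀ < s.re → g K s = f s) :
    ∃ G : ℂ → ℂ, Differentiable ℂ G ∧ ∀ K s, c K < s.re → G s = g K s := by
  have hopen : ∀ r : ℝ, IsOpen {s : ℂ | r < s.re} := fun r => isOpen_lt continuous_const continuous_re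
  have hagree : ∀ K L s, c K < s.re → c L < s.re → g K s = g L s := by
    intro K L s hK hL
    have hsub : ∀ M, c M ≤ max (c K) (c L) → DifferentiableOn ℂ (g M) {s | max (c K) (c L) < s.re} :=
      fun M hM => (hg M).mono fun z hz => hM.trans_lt hz
    refine AnalyticOnNhd.eqOn_of_preconnected_of_eventuallyEq
      ((hsub K (le_max_left _ _)).analyticOnNhd (hopen _))
      ((hsub L (le_max_right _ _)).analyticOnNhd (hopen _))
      (convex_halfSpace_re_gt _).isPreconnected
      (z₀ := ((c₀ + 1 : ℝ) : ℂ)) ?_ ?_ (max_lt hK hL)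
    · change max (c K) (c L) < ((c₀ + 1 : ℝ) : ℂ).re
      rw [ofReal_re]
      linarith [max_le (hc K) (hc L)]
    · filter_upwards [(hopen c₀).mem_nhds (show c₀ < ((c₀ + 1 : ℝ) : ℂ).re by simp)] with z hz
      rw [hf K z hz, hf L z hz]
  choose κ hκ using hlim
  refine ⟨fun s => g (κ s.re) s, fun s => ?_, fun K s hs => hagree _ _ s (hκ _) hs⟩
  have hd : DifferentiableAt ℂ (g (κ s.re)) s :=
    (hg _).differentiableAt ((hopen _).mem_nhds (hκ s.re))
  refine hd.congr_of_eventuallyEq ?_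
  filter_upwards [(hopen _).mem_nhds (hκ s.re)] with z hz
  exact hagree _ _ z (hκ _) hz

namespace IsExtendedSelberg

variable {a : ℕ → ℂ} {F : ℂ → ℂ} {D : GammaData}

theorem summable_conj (hF : IsExtendedSelberg a F D) {s : ℂ} (hs : 1 < s.re) :
    LSeriesSummable (fun n => conj (a n)) s := by
  have h : Summable (LSeries.term a (conj s)) := hF.summable (conj s) (by simpa using hs)
  rw [LSeriesSummable, funext (term_conj a s)]
  exact (Complex.hasSum_conj'.mpr (by simpa using h.hasSum)).summable

theorem conjFn_eq_LSeries (hF : IsExtendedSelberg a F D) {s : ℂ} (hs : 1 < s.re) :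
    conjFn F s = LSeries (fun n => conj (a n)) s := by
  rw [conjFn, hF.eq_LSeries _ (by simpa using hs), LSeries, LSeries, conj_tsum]
  exact tsum_congr fun n => (term_conj a s n).symm

end IsExtendedSelberg

namespace GammaData

variable (D : GammaData)

/-- The `n`-th term of an inner series, minus its binomial expansion of length `K`. -/
noncomputable def remTerm (a : ℕ → ℂ) (l : ℕ) (α : ℝ) (K : ℕ) (w : ℝ) (s : ℂ) (n : ℕ) : ℂ :=
  LSeries.term (fun n => conj (a n)) s n * (D.freqExp w s * (D.powTerm l α w s n -
    ∑ k ∈ range K, binom (D.expo l s) k * D.shift α w n ^ k))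

theorem norm_term_le (a : ℕ → ℂ) {x δ : ℝ} {s : ℂ} (hx : x ≤ s.re) {n : ℕ} (hn : n ≠ 0) :
    ‖LSeries.term (fun n => conj (a n)) s n‖ * (n : ℝ) ^ (-δ) ≤
      ‖LSeries.term (fun n => conj (a n)) (x + δ : ℝ) n‖ := by
  have hn1 : (0 : ℝ) < n := by exact_mod_cast Nat.pos_of_ne_zero hn
  rw [LSeries.norm_term_eq, LSeries.norm_term_eq, if_neg hn, if_neg hn, div_mul_eq_mul_div,
    ofReal_re, div_le_div_iff₀ (by positivity) (by positivity), mul_assoc]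
  gcongr
  rw [← Real.rpow_add hn1]
  refine Real.rpow_le_rpow_of_exponent_le ?_ (by linarith)
  exact_mod_cast Nat.one_le_iff_ne_zero.mpr hn

/-- The gain n^(-K/d) moves the Dirichlet series to abscissa x + K/d, so the remainders are summable
as soon as x + K/d > 1. -/
theorem exists_norm_remTerm_le (hd : 0 < D.degree) (a : ℕ → ℂ) {α : ℝ} (hα : 0 < α) {w : ℝ}
    (hw : w ∈ D.freqs) (l K : ℕ) (x y : ℝ) :
    ∃ C : ℝ, 0 ≤ C ∧ ∀ (n : ℕ) (s : ℂ), x ≤ s.re → s.re ≤ y →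
      ‖D.remTerm a l α K w s n‖ ≤
      C * (1 + |s.im|) ^ K * Real.exp (Real.pi / 2 * D.degree * |s.im|) *
        ‖LSeries.term (fun n => conj (a n)) (x + K / D.degree : ℝ) n‖ := by
  obtain ⟨h1, h2⟩ := D.abs_le_half_of_mem_freqs hd hw
  obtain ⟨C, hC, H⟩ := D.exists_norm_powTerm_sub_le hd hα h1 h2 l K x y
  refine ⟨C, hC, fun n s hx hy => ?_⟩
  by_cases hn : n = 0
  · simp [remTerm, hn]
  · rw [remTerm, norm_mul]
    calc _ ≤ ‖LSeries.term (fun n => conj (a n)) s n‖ * (C * (1 + |s.im|) ^ K *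
          Real.exp (Real.pi / 2 * D.degree * |s.im|) * (n : ℝ) ^ (-(K / D.degree))) := by
          gcongr; exact H n hn s hx hy
      _ = C * (1 + |s.im|) ^ K * Real.exp (Real.pi / 2 * D.degree * |s.im|) *
          (‖LSeries.term (fun n => conj (a n)) s n‖ * (n : ℝ) ^ (-(K / D.degree))) := by ring
      _ ≤ _ := by gcongr; exact norm_term_le a hx hn

theorem differentiable_powTerm (l : ℕ) {α : ℝ} {w : ℝ} (n : ℕ)
    (h : (n = 0 ∨ (w = -(1 / 2) ∧ (n : ℝ) = D.nAlpha α)) ∨ 1 + D.shift α w n ≠ 0) :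
    Differentiable ℂ fun s => D.powTerm l α w s n := by
  unfold powTerm
  split_ifs with h'
  · exact differentiable_const _
  · intro s
    refine DifferentiableAt.const_cpow ?_ (Or.inl (h.resolve_left h'))
    unfold expo
    fun_prop

/-- A zero base requires a shift of modulus 1, so n = n_α, and of phase π, so w = -1/2: precisely
the omitted term. -/
theorem shift_ne_neg_one (hd : 0 < D.degree) {α : ℝ} (hα : 0 < α) {w : ℝ}
    (h1 : -(1 / 2) ≤ w) (h2 : w ≤ 1 / 2) {n : ℕ} (hn : n ≠ 0)
    (h : ¬(w = -(1 / 2) ∧ (n : ℝ) = D.nAlpha α)) : 1 + D.shift α w n ≠ 0 := by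
  intro h0
  apply h
  have hpos := D.nAlpha_pos hd hα
  have hn1 : (0 : ℝ) < n := by exact_mod_cast Nat.pos_of_ne_zero hn
  have hs : D.shift α w n = -1 := by linear_combination h0
  have hn : (D.nAlpha α / n) ^ (1 / D.degree) = 1 := by
    rw [← D.norm_shift hd hα w, hs, norm_neg, norm_one]
  have hq : D.nAlpha α / n = 1 := by
    rw [← Real.rpow_inv_rpow (show 0 ≤ D.nAlpha α / n by positivity) hd.ne', ← one_div, hn,
      Real.one_rpow]
  have e : I * Real.pi * (1 / 2 - w) = ((Real.pi * (1 / 2 - w) : ℝ) : ℂ) * I := by push_cast; ring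
  rw [shift, hn, e, ofReal_one, mul_one] at hs
  have hc := congrArg re hs
  rw [exp_ofReal_mul_I_re, neg_re, one_re] at hc
  refine ⟨?_, by field_simp at hq; linarith⟩
  by_contra hw
  have hlt : -(1 / 2) < w := lt_of_le_of_ne h1 (Ne.symm hw)
  have := Real.cos_lt_cos_of_nonneg_of_le_pi (x := Real.pi * (1 / 2 - w)) (y := Real.pi)
    (mul_nonneg Real.pi_pos.le (by linarith)) le_rfl (by nlinarith [Real.pi_pos])
  rw [Real.cos_pi] at this
  linarith

theorem differentiable_remTerm (hd : 0 < D.degree) (a : ℕ → ℂ) {α : ℝ} (hα : 0 < α) {w : ℝ}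
    (hw : w ∈ D.freqs) (l K n : ℕ) : Differentiable ℂ fun s => D.remTerm a l α K w s n := by
  obtain ⟨h1, h2⟩ := D.abs_le_half_of_mem_freqs hd hw
  have hexpo : Differentiable ℂ fun s => D.expo l s := by unfold expo; fun_prop
  have hpow : Differentiable ℂ fun s => D.powTerm l α w s n := by
    refine D.differentiable_powTerm l n ?_
    by_cases h : n = 0 ∨ (w = -(1 / 2) ∧ (n : ℝ) = D.nAlpha α)
    · exact Or.inl h
    · rw [not_or] at h
      exact Or.inr (D.shift_ne_neg_one hd hα h1 h2 h.1 h.2)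
  unfold remTerm
  refine Differentiable.mul ?_ (Differentiable.mul ?_ (hpow.sub ?_))
  · by_cases hn : n = 0
    · simp [LSeries.term, hn]
    · simp only [LSeries.term, hn, if_false]
      intro s
      refine DifferentiableAt.div (by fun_prop) ?_ ?_
      · exact DifferentiableAt.const_cpow differentiableAt_id (Or.inl (by exact_mod_cast hn))
      · rw [Ne, cpow_eq_zero_iff]; simp [hn]
  · unfold freqExp; fun_prop
  · refine Differentiable.fun_sum fun k _ => Differentiable.mul ?_ (differentiable_const _)
    exact (differentiable_binom k).comp hexpo

/-- The part of the continuation coming from the remainders. -/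
noncomputable def remSum (a : ℕ → ℂ) (l : ℕ) (α : ℝ) (K : ℕ) (s : ℂ) : ℂ :=
  ∑ w ∈ D.freqs, D.coeff w * ∑' n, D.remTerm a l α K w s n

end GammaData

namespace IsExtendedSelberg

variable {a : ℕ → ℂ} {F : ℂ → ℂ} {D : GammaData}

theorem summable_remTerm (hF : IsExtendedSelberg a F D) (hd : 0 < D.degree) {α : ℝ} (hα : 0 < α)
    {w : ℝ} (hw : w ∈ D.freqs) (l K : ℕ) {s : ℂ} (hs : 1 < s.re + K / D.degree) :
    Summable fun n => D.remTerm a l α K w s n := by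
  obtain ⟨C, hC, H⟩ := D.exists_norm_remTerm_le hd a hα hw l K s.re s.re
  exact Summable.of_norm_bounded (((hF.summable_conj (s := ((s.re + K / D.degree : ℝ) : ℂ))
    (by simpa using hs)).norm).mul_left _) fun n => H n s le_rfl le_rfl

theorem exists_norm_remSum_le (hF : IsExtendedSelberg a F D) (hd : 0 < D.degree) {α : ℝ}
    (hα : 0 < α) (l K : ℕ) {x : ℝ} (y : ℝ) (hx : 1 < x + K / D.degree) :
    ∃ C : ℝ, 0 ≤ C ∧ ∀ s : ℂ, x ≤ s.re → s.re ≤ y → ‖D.remSum a l α K s‖ ≤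
      C * (1 + |s.im|) ^ K * Real.exp (Real.pi / 2 * D.degree * |s.im|) := by
  have hsum := (hF.summable_conj (s := ((x + K / D.degree : ℝ) : ℂ)) (by simpa using hx)).norm
  have H : ∀ w ∈ D.freqs, ∃ C : ℝ, 0 ≤ C ∧ ∀ s : ℂ, x ≤ s.re → s.re ≤ y →
      ‖D.coeff w * ∑' n, D.remTerm a l α K w s n‖ ≤
        C * ((1 + |s.im|) ^ K * Real.exp (Real.pi / 2 * D.degree * |s.im|)) := by
    intro w hw
    obtain ⟨C, hC, H⟩ := D.exists_norm_remTerm_le hd a hα hw l K x y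
    refine ⟨‖D.coeff w‖ * (C * ∑' n, ‖LSeries.term (fun n => conj (a n))
      (x + K / D.degree : ℝ) n‖), mul_nonneg (norm_nonneg _)
      (mul_nonneg hC (tsum_nonneg fun _ => norm_nonneg _)), fun s hsx hsy => ?_⟩
    have h1 := tsum_of_norm_bounded (hsum.mul_left (C * (1 + |s.im|) ^ K *
      Real.exp (Real.pi / 2 * D.degree * |s.im|))).hasSum fun n => H n s hsx hsy
    rw [tsum_mul_left] at h1
    rw [norm_mul]
    calc _ ≤ ‖D.coeff w‖ * _ := mul_le_mul_of_nonneg_left h1 (norm_nonneg _)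
      _ = _ := by ring
  choose! C hC H using H
  refine ⟨∑ w ∈ D.freqs, C w, Finset.sum_nonneg hC, fun s hsx hsy => ?_⟩
  rw [GammaData.remSum, mul_assoc, Finset.sum_mul]
  exact (norm_sum_le _ _).trans (Finset.sum_le_sum fun w hw => H w hw s hsx hsy)

theorem differentiableOn_remSum (hF : IsExtendedSelberg a F D) (hd : 0 < D.degree) {α : ℝ}
    (hα : 0 < α) (l K : ℕ) :
    DifferentiableOn ℂ (D.remSum a l α K) {s | 1 - K / D.degree < s.re} := by
  intro s₀ hs₀
  refine DifferentiableAt.differentiableWithinAt ?_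
  unfold GammaData.remSum
  refine DifferentiableAt.fun_sum fun w hw => DifferentiableAt.const_mul ?_ _
  have hs₀' : 1 - K / D.degree < s₀.re := hs₀
  -- The midpoint leaves room on both sides: x < Re s₀ and x + K/d > 1.
  set x := (1 - K / D.degree + s₀.re) / 2 with hx
  have hsum := (hF.summable_conj (s := ((x + K / D.degree : ℝ) : ℂ))
    (by rw [ofReal_re, hx]; linarith)).norm
  obtain ⟨C, hC, H⟩ := D.exists_norm_remTerm_le hd a hα hw l K x (s₀.re + 1)
  set U : Set ℂ := {s | x < s.re} ∩ {s | s.re < s₀.re + 1} ∩ {s | |s.im| < |s₀.im| + 1} with hU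
  have hUo : IsOpen U := ((isOpen_lt continuous_const continuous_re).inter
    (isOpen_lt continuous_re continuous_const)).inter
    (isOpen_lt (continuous_abs.comp continuous_im) continuous_const)
  have hmem : s₀ ∈ U := ⟨⟨show x < s₀.re by linarith, by simp⟩, by simp⟩
  refine (Complex.differentiableOn_tsum_of_summable_norm
    (hsum.mul_left (C * (1 + (|s₀.im| + 1)) ^ K *
      Real.exp (Real.pi / 2 * D.degree * (|s₀.im| + 1))))
    (fun n => (D.differentiable_remTerm hd a hα hw l K n).differentiableOn) hUo
    fun n s hs => (H n s hs.1.1.le hs.1.2.le).trans ?_).differentiableAt (hUo.mem_nhds hmem)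
  have h2 : |s.im| ≤ |s₀.im| + 1 := le_of_lt hs.2
  gcongr

end IsExtendedSelberg

namespace GammaData

variable (D : GammaData)

theorem term_mul_shift_pow (hd : 0 < D.degree) (a : ℕ → ℂ) {α : ℝ} (hα : 0 < α) (w : ℝ) (s : ℂ)
    (n k : ℕ) :
    LSeries.term a s n * D.shift α w n ^ k =
      exp (I * Real.pi * (1 / 2 - w)) ^ k * ((D.nAlpha α ^ (k / D.degree) : ℝ) : ℂ) *
        LSeries.term a (s + (k / D.degree : ℝ)) n := by
  have hpos := D.nAlpha_pos hd hα
  have h : ((D.nAlpha α / n) ^ (1 / D.degree)) ^ k =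
      D.nAlpha α ^ (k / D.degree) * (n : ℝ) ^ (-(k / D.degree)) := by
    rw [← Real.rpow_natCast, ← Real.rpow_mul (by positivity),
      Real.div_rpow hpos.le n.cast_nonneg, Real.rpow_neg n.cast_nonneg, div_eq_mul_inv, one_div,
      inv_mul_eq_div]
  rw [shift, mul_pow, ← ofReal_pow, h, term_add_right, ofReal_mul, ofReal_cpow n.cast_nonneg]
  push_cast
  ring

/-- The part of the continuation coming from the binomial expansion. -/
noncomputable def mainPart (h : ℂ → ℂ) (l : ℕ) (α : ℝ) (K : ℕ) (s : ℂ) : ℂ :=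
  ∑ k ∈ range K, I ^ k * ((D.nAlpha α ^ (k / D.degree) : ℝ) : ℂ) * binom (D.expo l s) k *
    h (s + (k / D.degree : ℝ))

theorem differentiable_mainPart {h : ℂ → ℂ} (hh : Differentiable ℂ h) (l : ℕ) (α : ℝ) (K : ℕ) :
    Differentiable ℂ (D.mainPart h l α K) := by
  have hexpo : Differentiable ℂ fun s => D.expo l s := by unfold expo; fun_prop
  unfold mainPart
  refine Differentiable.fun_sum fun k _ => Differentiable.mul (Differentiable.mul (by fun_prop) ?_) ?_
  · exact (differentiable_binom k).comp hexpo
  · exact hh.comp (by fun_prop)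

theorem exists_norm_mainPart_le (hd : 1 ≤ D.degree) {h : ℂ → ℂ} (l : ℕ) {α : ℝ} (hα : 0 < α)
    (K : ℕ) {x y C : ℝ} {N : ℕ}
    (hb : ∀ s : ℂ, x ≤ s.re → s.re ≤ y + K → 1 ≤ |s.im| →
      ‖h s‖ ≤ C * Real.exp (Real.pi / 2 * D.degree * |s.im|) * |s.im| ^ N) :
    ∃ C' : ℝ, 0 ≤ C' ∧ ∀ s : ℂ, x ≤ s.re → s.re ≤ y → 1 ≤ |s.im| → ‖D.mainPart h l α K s‖ ≤
      C' * Real.exp (Real.pi / 2 * D.degree * |s.im|) * |s.im| ^ (K + N) := by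
  have hd0 : 0 < D.degree := by linarith
  have hpos := D.nAlpha_pos hd0 hα
  obtain ⟨R, hR1, hR⟩ := D.exists_expo_bounds hd0 l K x y
  refine ⟨∑ k ∈ range K, D.nAlpha α ^ (k / D.degree) * (2 * R) ^ K * |C|, by positivity,
    fun s hx hy ht => ?_⟩
  rw [mainPart, Finset.sum_mul, Finset.sum_mul]
  refine (norm_sum_le _ _).trans (Finset.sum_le_sum fun k hk => ?_)
  have hkK : (k : ℝ) ≤ K := by exact_mod_cast (Finset.mem_range.mp hk).le
  have hkd0 : 0 ≤ k / D.degree := by positivity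
  -- Here d ≥ 1 keeps every shifted argument s + k/d within the strip of width y + K where h is
  -- controlled.
  have hkd : k / D.degree ≤ K := (div_le_self k.cast_nonneg hd).trans hkK
  have him : (s + (k / D.degree : ℝ)).im = s.im := by rw [add_im, ofReal_im, add_zero]
  have hre : (s + (k / D.degree : ℝ)).re = s.re + k / D.degree := by rw [add_re, ofReal_re]
  have h1 := hb (s + (k / D.degree : ℝ)) (by rw [hre]; linarith) (by rw [hre]; linarith)
    (by rw [him]; exact ht)
  rw [him] at h1
  have h2 : ‖binom (D.expo l s) k‖ ≤ (2 * R) ^ K * |s.im| ^ K := by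
    rw [← mul_pow]
    have h3 : ‖D.expo l s‖ + k ≤ 2 * R * |s.im| := by
      have := (hR s hx hy).1
      nlinarith
    have h4 : 1 ≤ 2 * R * |s.im| := by nlinarith
    calc _ ≤ (‖D.expo l s‖ + k) ^ k := norm_binom_le _ _
      _ ≤ (2 * R * |s.im|) ^ k := by gcongr
      _ ≤ _ := pow_le_pow_right₀ h4 (Finset.mem_range.mp hk).le
  rw [norm_mul, norm_mul, norm_mul, norm_pow, norm_I, one_pow, one_mul, norm_real,
    Real.norm_eq_abs, abs_of_pos (Real.rpow_pos_of_pos hpos _)]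
  calc _ ≤ D.nAlpha α ^ (k / D.degree) * ((2 * R) ^ K * |s.im| ^ K) *
        (|C| * Real.exp (Real.pi / 2 * D.degree * |s.im|) * |s.im| ^ N) := by
        gcongr
        refine h1.trans ?_
        gcongr
        exact le_abs_self C
    _ = _ := by rw [pow_add]; ring

/-- Since e^(iπ(1/2-w)k) = i^k e^(-iπwk), the phase just moves the argument of e^(iπdw·) from 1 - s
to 1 - s - k/d. -/
theorem sum_coeff_mul_freqExp (s : ℂ) (hd : D.degree ≠ 0) (k : ℕ) :
    ∑ w ∈ D.freqs, D.coeff w * D.freqExp w s * exp (I * Real.pi * (1 / 2 - w)) ^ k =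
      I ^ k * D.sineProd (1 - (s + (k / D.degree : ℝ))) := by
  rw [sineProd_eq_sum, Finset.mul_sum]
  refine Finset.sum_congr rfl fun w _ => ?_
  have hI : I = exp (Real.pi / 2 * I) := exp_pi_div_two_mul_I.symm
  have hd' : (D.degree : ℂ) ≠ 0 := by exact_mod_cast hd
  have hIk : I ^ k = exp (k * (Real.pi / 2 * I)) := by rw [exp_nat_mul, ← hI]
  rw [freqExp, hIk, ← exp_nat_mul, mul_assoc, ← exp_add,
    mul_left_comm (exp (k * (Real.pi / 2 * I))), ← exp_add]
  congr 2
  push_cast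
  field_simp
  ring

end GammaData

namespace IsExtendedSelberg

variable {a : ℕ → ℂ} {F : ℂ → ℂ} {D : GammaData}

theorem summable_innerTerm (hF : IsExtendedSelberg a F D) (hd : 0 < D.degree) {α : ℝ} (hα : 0 < α)
    {w : ℝ} (hw : w ∈ D.freqs) (l : ℕ) {s : ℂ} (hs : 1 < s.re) :
    Summable (D.innerTerm a l α w s) := by
  -- With K = 0 nothing is subtracted: the remainder is the inner term times a nonzero factor.
  have h := hF.summable_remTerm hd hα hw l 0 (s := s) (by simpa using hs)
  have hf : D.freqExp w s ≠ 0 := exp_ne_zero _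
  have h2 := h.mul_left (D.freqExp w s)⁻¹
  refine h2.congr fun n => ?_
  rw [GammaData.remTerm, D.innerTerm_eq]
  simp only [Finset.range_zero, Finset.sum_empty, sub_zero]
  field_simp

/-- The truncated expansion is added and subtracted under the sum over n; after the finite sums over
w and k are exchanged, the frequencies recombine into h(s + k/d). -/
theorem fBar_eq (hF : IsExtendedSelberg a F D) (hd : 0 < D.degree) {h : ℂ → ℂ}
    (hh : ∀ s, s ≠ 1 → h s = D.sineProd (1 - s) * conjFn F s) (l : ℕ) {α : ℝ} (hα : 0 < α)
    (K : ℕ) {s : ℂ} (hs : 1 < s.re) :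
    D.mainPart h l α K s + D.remSum a l α K s = D.fBar a l α s := by
  set b : ℕ → ℂ := fun n => conj (a n) with hb
  have hsk : ∀ k : ℕ, 1 < (s + (k / D.degree : ℝ)).re := fun k => by
    rw [add_re, ofReal_re]
    have : 0 ≤ k / D.degree := by positivity
    linarith
  have hw : ∀ w ∈ D.freqs, D.freqExp w s * ∑' n, D.innerTerm a l α w s n =
      (∑' n, D.remTerm a l α K w s n) + ∑ k ∈ range K, D.freqExp w s *
        exp (I * Real.pi * (1 / 2 - w)) ^ k * ((D.nAlpha α ^ (k / D.degree) : ℝ) : ℂ) *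
        binom (D.expo l s) k * LSeries b (s + (k / D.degree : ℝ)) := by
    intro w hw
    have h1 : ∀ n, D.freqExp w s * D.innerTerm a l α w s n = D.remTerm a l α K w s n +
        ∑ k ∈ range K, D.freqExp w s * exp (I * Real.pi * (1 / 2 - w)) ^ k *
          ((D.nAlpha α ^ (k / D.degree) : ℝ) : ℂ) * binom (D.expo l s) k *
          LSeries.term b (s + (k / D.degree : ℝ)) n := by
      intro n
      have h2 : ∀ k : ℕ, D.freqExp w s * exp (I * Real.pi * (1 / 2 - w)) ^ k *
          ((D.nAlpha α ^ (k / D.degree) : ℝ) : ℂ) * binom (D.expo l s) k *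
          LSeries.term b (s + (k / D.degree : ℝ)) n = LSeries.term b s n * D.freqExp w s *
            (binom (D.expo l s) k * D.shift α w n ^ k) := fun k => by
        linear_combination (-(D.freqExp w s * binom (D.expo l s) k)) *
          D.term_mul_shift_pow hd b hα w s n k
      rw [Finset.sum_congr rfl fun k _ => h2 k, ← Finset.mul_sum, GammaData.remTerm, D.innerTerm_eq]
      ring
    rw [← tsum_mul_left, tsum_congr h1, Summable.tsum_add, Summable.tsum_finsetSum]
    · congr 1
      refine Finset.sum_congr rfl fun k _ => ?_
      rw [tsum_mul_left, LSeries]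
    · exact fun k _ => Summable.mul_left _ (hF.summable_conj (hsk k))
    · refine hF.summable_remTerm hd hα hw l K ?_
      have : 0 ≤ K / D.degree := by positivity
      linarith
    · exact summable_sum fun k _ => Summable.mul_left _ (hF.summable_conj (hsk k))
  have h3 : D.fBar a l α s = ∑ w ∈ D.freqs,
      D.coeff w * (D.freqExp w s * ∑' n, D.innerTerm a l α w s n) := by
    rw [GammaData.fBar]
    exact Finset.sum_congr rfl fun w _ => by rw [GammaData.freqExp, mul_assoc]
  rw [h3, Finset.sum_congr rfl fun w hw' => by rw [hw w hw', mul_add], Finset.sum_add_distrib,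
    GammaData.remSum, add_comm]
  congr 1
  simp_rw [Finset.mul_sum]
  rw [Finset.sum_comm, GammaData.mainPart]
  refine Finset.sum_congr rfl fun k _ => ?_
  have hne : s + (k / D.degree : ℝ) ≠ 1 := fun h1 => by
    have := hsk k
    rw [h1, one_re] at this
    exact lt_irrefl _ this
  rw [hh _ hne, hF.conjFn_eq_LSeries (hsk k)]
  have := D.sum_coeff_mul_freqExp s hd.ne' k
  calc _ = (I ^ k * D.sineProd (1 - (s + (k / D.degree : ℝ)))) *
        (((D.nAlpha α ^ (k / D.degree) : ℝ) : ℂ) * binom (D.expo l s) k *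
          LSeries b (s + (k / D.degree : ℝ))) := by ring
    _ = _ := by
        rw [← this, Finset.sum_mul]
        exact Finset.sum_congr rfl fun w _ => by ring

/-- The analytic continuation of `F̄_ℓ(s, α)` with its growth in vertical strips. -/
theorem exists_continuation (hF : IsExtendedSelberg a F D) (hd : 1 ≤ D.degree) {h : ℂ → ℂ}
    (hhd : Differentiable ℂ h) (hh : ∀ s, s ≠ 1 → h s = D.sineProd (1 - s) * conjFn F s) (l : ℕ)
    {α : ℝ} (hα : 0 < α) :
    ∃ G : ℂ → ℂ, Differentiable ℂ G ∧ (∀ s : ℂ, 1 < s.re → G s = D.fBar a l α s) ∧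
      (∀ x y : ℝ, 1 < x → ∃ C : ℝ, 0 ≤ C ∧ ∀ s : ℂ, x ≤ s.re → s.re ≤ y →
        ‖G s‖ ≤ C * Real.exp (Real.pi / 2 * D.degree * |s.im|)) ∧
      ∀ (K : ℕ) (x y C : ℝ) (N : ℕ), 1 < x + K / D.degree →
        (∀ s : ℂ, x ≤ s.re → s.re ≤ y + K → 1 ≤ |s.im| →
          ‖h s‖ ≤ C * Real.exp (Real.pi / 2 * D.degree * |s.im|) * |s.im| ^ N) →
        ∃ C' : ℝ, 0 ≤ C' ∧ ∀ s : ℂ, x ≤ s.re → s.re ≤ y → 1 ≤ |s.im| →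
          ‖G s‖ ≤ C' * Real.exp (Real.pi / 2 * D.degree * |s.im|) * |s.im| ^ (K + N) := by
  have hd0 : 0 < D.degree := by linarith
  obtain ⟨G, hGd, hG⟩ := exists_entire_of_halfPlanes
    (g := fun K s => D.mainPart h l α K s + D.remSum a l α K s) (f := D.fBar a l α)
    (c := fun K => 1 - K / D.degree) (c₀ := 1)
    (fun K => by have : 0 ≤ K / D.degree := by positivity
                 linarith)
    (fun r => by
      obtain ⟨K, hK⟩ := exists_nat_gt ((1 - r) * D.degree)
      refine ⟨K, ?_⟩
      rw [← lt_div_iff₀ hd0] at hK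
      linarith)
    (fun K => (D.differentiable_mainPart hhd l α K).differentiableOn.add
      (hF.differentiableOn_remSum hd0 hα l K))
    (fun K s hs => hF.fBar_eq hd0 hh l hα K hs)
  refine ⟨G, hGd, fun s hs => ?_, fun x y hx => ?_, fun K x y C N hx hb => ?_⟩
  · rw [hG 0 s (by simpa using hs)]
    exact hF.fBar_eq hd0 hh l hα 0 hs
  · obtain ⟨C, hC, H⟩ := hF.exists_norm_remSum_le hd0 hα l 0 y (by simpa using hx)
    refine ⟨C, hC, fun s hsx hsy => ?_⟩
    rw [hG 0 s (by simpa using hx.trans_le hsx)]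
    simpa [GammaData.mainPart] using H s hsx hsy
  · obtain ⟨C₁, hC₁, H₁⟩ := hF.exists_norm_remSum_le hd0 hα l K y hx
    obtain ⟨C₂, hC₂, H₂⟩ := D.exists_norm_mainPart_le hd l hα K hb
    refine ⟨C₂ + C₁ * 2 ^ K, by positivity, fun s hsx hsy ht => ?_⟩
    rw [hG K s (show 1 - K / D.degree < s.re by linarith)]
    refine (norm_add_le _ _).trans ?_
    rw [add_mul, add_mul]
    refine add_le_add (H₂ s hsx hsy ht) ((H₁ s hsx hsy).trans ?_)
    calc _ ≤ C₁ * (2 * |s.im|) ^ K * Real.exp (Real.pi / 2 * D.degree * |s.im|) := by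
          gcongr; linarith
      _ = C₁ * 2 ^ K * Real.exp (Real.pi / 2 * D.degree * |s.im|) * |s.im| ^ K := by
          rw [mul_pow]; ring
      _ ≤ _ := by
          refine mul_le_mul_of_nonneg_left (pow_le_pow_right₀ ht (Nat.le_add_right _ _)) ?_
          positivity

end IsExtendedSelberg

/-! ### Interpolation near the line Re s = 1 -/

/-- A Phragmén–Lindelöf type bound to the right of the line `Re s = 1`, for functions growing like
`e^(A |t|) |t|^B` which are `O(e^(A |t|))` on every line to the right of it. -/
theorem exists_norm_le_rpow_of_edges {G : ℂ → ℂ} (hG : Differentiable ℂ G) {A : ℝ} (hA : 0 ≤ A)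
    {B : ℕ} {C : ℝ} (hC : 0 ≤ C)
    (h0 : ∀ s : ℂ, 0 ≤ s.re → s.re ≤ 2 → 1 ≤ |s.im| →
      ‖G s‖ ≤ C * Real.exp (A * |s.im|) * |s.im| ^ B)
    (h1 : ∀ x : ℝ, 1 < x → ∃ C : ℝ, 0 ≤ C ∧ ∀ s : ℂ, s.re = x → ‖G s‖ ≤ C * Real.exp (A * |s.im|))
    {ε : ℝ} (hε : 0 < ε) :
    ∃ C' η : ℝ, 0 ≤ C' ∧ 0 < η ∧ ∀ s : ℂ, 1 ≤ s.re → s.re ≤ 1 + η → 1 ≤ |s.im| →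
      ‖G s‖ ≤ C' * (Real.exp (A * |s.im|) * |s.im| ^ ε) := by
  -- Interpolation at distance at most η from the right edge costs |t|^(Bη), and Bη ≤ ε.
  set η := min 1 (ε / (B + 1)) with hη
  have hη0 : 0 < η := lt_min one_pos (by positivity)
  have hη1 : η ≤ 1 := min_le_left _ _
  have hBη : B * η ≤ ε := by
    have : η ≤ ε / (B + 1) := min_le_right _ _
    rw [le_div_iff₀ (by positivity)] at this
    nlinarith
  obtain ⟨C₁, hC₁, H₁⟩ := h1 (1 + η) (by linarith)
  obtain ⟨C₂, hC₂⟩ := (isCompact_Icc.reProdIm isCompact_Icc :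
    IsCompact (Set.Icc (0 : ℝ) 2 ×ℂ Set.Icc (-1 : ℝ) 1)).exists_bound_of_continuousOn
    hG.continuous.continuousOn
  have hall : ∀ s : ℂ, 0 ≤ s.re → s.re ≤ 2 →
      ‖G s‖ ≤ (C + |C₂|) * Real.exp (A * |s.im|) * (1 + |s.im|) ^ B := by
    intro s hs0 hs2
    rcases le_total 1 |s.im| with ht | ht
    · refine (h0 s hs0 hs2 ht).trans ?_
      gcongr
      · linarith [abs_nonneg C₂]
      · linarith
    · have h := hC₂ s ⟨⟨hs0, hs2⟩, abs_le.mp ht⟩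
      have h2 : 1 ≤ Real.exp (A * |s.im|) := Real.one_le_exp (by positivity)
      have h3 : 1 ≤ (1 + |s.im|) ^ B := one_le_pow₀ (by linarith [abs_nonneg s.im])
      calc _ ≤ C + |C₂| := h.trans (by linarith [le_abs_self C₂])
        _ ≤ (C + |C₂|) * Real.exp (A * |s.im|) := le_mul_of_one_le_right (by positivity) h2
        _ ≤ _ := le_mul_of_one_le_right (by positivity) h3
  -- With v = t - t₀, this is the maximum of exp(4 + (2A + B)|v| - v²), where 4 bounds (Re s)².
  set P := Real.exp (4 + (2 * A + B) ^ 2 / 4) with hP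
  set M := max (max ((C + |C₂|) * P) (C₁ * P)) 1 with hM
  have hM1 : 1 ≤ M := le_max_right _ _
  refine ⟨M * 2 ^ ε, η, by positivity, hη0, fun s₀ hs1 hs2 ht₀ => ?_⟩
  obtain ⟨τ, hτ, hτt⟩ : ∃ τ : ℝ, |τ| = 1 ∧ τ * s₀.im = |s₀.im| := by
    rcases le_total 0 s₀.im with h | h
    · exact ⟨1, by simp, by rw [abs_of_nonneg h, one_mul]⟩
    · exact ⟨-1, by simp, by rw [abs_of_nonpos h]; ring⟩
  -- With τ the sign of t₀, the first exponential cancels e^(A|t|) on the side of t₀. The Gaussian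
  -- centred at height t₀ absorbs the growth on the other side and localizes the powers of |t| at
  -- |t₀|.
  set f : ℂ → ℂ := fun s => G s * (exp (I * (A * τ : ℝ) * s) * exp ((s - s₀.im * I) ^ 2)) with hf
  have hfd : Differentiable ℂ f := by rw [hf]; fun_prop
  have hnorm : ∀ s : ℂ, ‖exp (I * (A * τ : ℝ) * s) * exp ((s - s₀.im * I) ^ 2)‖ =
      Real.exp (-(A * (τ * s.im)) + (s.re ^ 2 - (s.im - s₀.im) ^ 2)) := by
    intro s
    rw [← exp_add, norm_exp]
    congr 1
    simp [pow_two]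
    ring
  have hkey : ∀ s : ℂ, 0 ≤ s.re → s.re ≤ 2 →
      Real.exp (A * |s.im|) * (1 + |s.im - s₀.im|) ^ B *
        Real.exp (-(A * (τ * s.im)) + (s.re ^ 2 - (s.im - s₀.im) ^ 2)) ≤ P := by
    intro s hs0 hs2
    set v := s.im - s₀.im with hv
    have h2 : |s.im| - τ * s.im ≤ 2 * |v| := by
      have e : s.im = s₀.im + v := by rw [hv]; ring
      have h3 : |s.im| ≤ |s₀.im| + |v| := by rw [e]; exact abs_add_le _ _
      have h4 : -(τ * v) ≤ |v| := by
        refine (neg_le_abs _).trans (le_of_eq ?_)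
        rw [abs_mul, hτ, one_mul]
      have h5 : τ * s.im = |s₀.im| + τ * v := by rw [e, mul_add, hτt]
      linarith
    have h6 : (1 + |v|) ^ B ≤ Real.exp (B * |v|) := by
      rw [Real.exp_nat_mul]
      have := Real.add_one_le_exp |v|
      gcongr
      linarith
    calc _ ≤ Real.exp (A * |s.im|) * Real.exp (B * |v|) *
          Real.exp (-(A * (τ * s.im)) + (s.re ^ 2 - v ^ 2)) := by gcongr
      _ = Real.exp (A * (|s.im| - τ * s.im) + B * |v| + s.re ^ 2 - v ^ 2) := by
          rw [← Real.exp_add, ← Real.exp_add]; congr 1; ring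
      _ ≤ P := by
          rw [hP, Real.exp_le_exp]
          have h7 := mul_le_mul_of_nonneg_left h2 hA
          have h8 : s.re ^ 2 ≤ 4 := by nlinarith
          have h9 : v ^ 2 = |v| ^ 2 := (sq_abs v).symm
          nlinarith [sq_nonneg (|v| - (2 * A + B) / 2)]
  have hstrip : ∀ s : ℂ, 0 ≤ s.re → s.re ≤ 2 → ‖f s‖ ≤ M * (1 + |s₀.im|) ^ B := by
    intro s hs0 hs2
    have h2 : 1 + |s.im| ≤ (1 + |s₀.im|) * (1 + |s.im - s₀.im|) := by
      have : |s.im| ≤ |s₀.im| + |s.im - s₀.im| := by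
        calc |s.im| = |s₀.im + (s.im - s₀.im)| := by rw [add_sub_cancel]
          _ ≤ _ := abs_add_le _ _
      nlinarith [mul_nonneg (abs_nonneg s₀.im) (abs_nonneg (s.im - s₀.im))]
    rw [hf]
    simp only
    rw [norm_mul, hnorm]
    calc _ ≤ ((C + |C₂|) * Real.exp (A * |s.im|) *
          ((1 + |s₀.im|) * (1 + |s.im - s₀.im|)) ^ B) *
          Real.exp (-(A * (τ * s.im)) + (s.re ^ 2 - (s.im - s₀.im) ^ 2)) := by
          gcongr
          refine (hall s hs0 hs2).trans ?_
          gcongr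
      _ = (C + |C₂|) * (Real.exp (A * |s.im|) * (1 + |s.im - s₀.im|) ^ B *
          Real.exp (-(A * (τ * s.im)) + (s.re ^ 2 - (s.im - s₀.im) ^ 2))) * (1 + |s₀.im|) ^ B := by
          rw [mul_pow]; ring
      _ ≤ (C + |C₂|) * P * (1 + |s₀.im|) ^ B := by gcongr; exact hkey s hs0 hs2
      _ ≤ _ := by
          gcongr
          exact (le_max_left _ _).trans (le_max_left _ _)
  have hright : ∀ s : ℂ, s.re = 1 + η → ‖f s‖ ≤ M := by
    intro s hs
    have h2 : (1 : ℝ) ≤ (1 + |s.im - s₀.im|) ^ B :=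
      one_le_pow₀ (by linarith [abs_nonneg (s.im - s₀.im)])
    rw [hf]
    simp only
    rw [norm_mul, hnorm]
    calc _ ≤ (C₁ * Real.exp (A * |s.im|)) *
          Real.exp (-(A * (τ * s.im)) + (s.re ^ 2 - (s.im - s₀.im) ^ 2)) := by
          gcongr; exact H₁ s hs
      _ ≤ (C₁ * Real.exp (A * |s.im|)) * (1 + |s.im - s₀.im|) ^ B *
          Real.exp (-(A * (τ * s.im)) + (s.re ^ 2 - (s.im - s₀.im) ^ 2)) := by
          refine mul_le_mul_of_nonneg_right ?_ (Real.exp_pos _).le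
          exact le_mul_of_one_le_right (by positivity) h2
      _ = C₁ * (Real.exp (A * |s.im|) * (1 + |s.im - s₀.im|) ^ B *
          Real.exp (-(A * (τ * s.im)) + (s.re ^ 2 - (s.im - s₀.im) ^ 2))) := by ring
      _ ≤ C₁ * P := by gcongr; exact hkey s (by linarith) (by linarith)
      _ ≤ M := (le_max_right _ _).trans (le_max_left _ _)
  -- The edge Re s = 0 carries (1 + |t₀|)^B with weight 1 - θ ≤ η; the edge Re s = 1 + η carries
  -- only a constant. M does not depend on s₀.
  have hthree := Complex.HadamardThreeLines.norm_le_interp_of_mem_verticalClosedStrip'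
    (f := f) (z := s₀) (l := 0) (u := 1 + η) (a := M * (1 + |s₀.im|) ^ B) (b := M)
    (by linarith) ⟨by linarith, hs2⟩ hfd.diffContOnCl
    ⟨M * (1 + |s₀.im|) ^ B, by
      rintro _ ⟨s, hs, rfl⟩
      exact hstrip s hs.1 (hs.2.trans (by linarith))⟩
    (fun s hs => hstrip s (by rw [Set.mem_preimage, Set.mem_singleton_iff] at hs; exact hs.ge)
      (by rw [Set.mem_preimage, Set.mem_singleton_iff] at hs; rw [hs]; norm_num))
    (fun s hs => hright s hs)
  rw [sub_zero, sub_zero] at hthree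
  set θ := s₀.re / (1 + η) with hθ
  have hθ1 : 1 - θ ≤ η := by
    have h2 : 1 - θ = (1 + η - s₀.re) / (1 + η) := by rw [hθ]; field_simp
    rw [h2, div_le_iff₀ (by linarith)]
    nlinarith
  have hinterp : (M * (1 + |s₀.im|) ^ B) ^ (1 - θ) * M ^ θ ≤ M * 2 ^ ε * |s₀.im| ^ ε := by
    have hM0 : 0 < M := by linarith
    have h3 : 1 ≤ 1 + |s₀.im| := by linarith
    rw [Real.mul_rpow hM0.le (by positivity), mul_right_comm, ← Real.rpow_add hM0,
      sub_add_cancel, Real.rpow_one, mul_assoc, ← Real.mul_rpow two_pos.le (abs_nonneg _),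
      ← Real.rpow_natCast, ← Real.rpow_mul (by linarith)]
    gcongr
    calc (1 + |s₀.im|) ^ (B * (1 - θ)) ≤ (1 + |s₀.im|) ^ ε :=
          Real.rpow_le_rpow_of_exponent_le h3
            ((mul_le_mul_of_nonneg_left hθ1 B.cast_nonneg).trans hBη)
      _ ≤ _ := Real.rpow_le_rpow (by linarith) (by linarith) hε.le
  have hlow : ‖G s₀‖ ≤ ‖f s₀‖ * Real.exp (A * |s₀.im|) := by
    rw [hf]
    simp only
    rw [norm_mul, hnorm, mul_assoc, ← Real.exp_add, hτt]
    refine le_mul_of_one_le_right (norm_nonneg _) (Real.one_le_exp ?_)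
    have : -(A * |s₀.im|) + (s₀.re ^ 2 - (s₀.im - s₀.im) ^ 2) + A * |s₀.im| = s₀.re ^ 2 := by ring
    rw [this]
    positivity
  calc ‖G s₀‖ ≤ ‖f s₀‖ * Real.exp (A * |s₀.im|) := hlow
    _ ≤ (M * 2 ^ ε * |s₀.im| ^ ε) * Real.exp (A * |s₀.im|) := by
        gcongr; exact hthree.trans hinterp
    _ = _ := by ring

/-! ### Nonvanishing -/

theorem tendsto_average_exp {z : ℂ} (hz : z ≠ 0) (hre : z.re ≤ 0) :
    Filter.Tendsto (fun T : ℝ => (∫ t in (0 : ℝ)..T, exp (z * t)) / T) Filter.atTop (𝓝 0) := by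
  have hlim : Filter.Tendsto (fun T : ℝ => 2 / ‖z‖ / T) Filter.atTop (𝓝 0) :=
    Filter.Tendsto.const_div_atTop Filter.tendsto_id _
  refine squeeze_zero_norm' ?_ hlim
  filter_upwards [Filter.eventually_gt_atTop 0] with T hT
  rw [norm_div, norm_real, Real.norm_eq_abs, abs_of_pos hT, integral_exp_mul_complex hz, norm_div]
  gcongr
  refine (norm_sub_le _ _).trans ?_
  have h1 : ‖exp (z * T)‖ ≤ 1 := by
    rw [norm_exp, Real.exp_le_one_iff]
    simpa using mul_nonpos_of_nonpos_of_nonneg hre hT.le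
  have h2 : ‖exp (z * (0 : ℝ))‖ = 1 := by simp
  linarith

/-- Uniqueness of coefficients of an absolutely convergent exponential sum, for the terms which do
not decay. -/
theorem coeff_eq_zero_of_tsum_exp_eq_zero {ι : Type*} [Countable ι] {c ζ : ι → ℂ} (i₀ : ι)
    (hs : Summable fun i => ‖c i‖) (hre : ∀ i, c i ≠ 0 → (ζ i).re ≤ 0) (h0 : (ζ i₀).re = 0)
    (hne : ∀ i, i ≠ i₀ → c i ≠ 0 → ζ i ≠ ζ i₀)
    (hf : ∀ t : ℝ, ∑' i, c i * exp (ζ i * t) = 0) : c i₀ = 0 := by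
  classical
  have hnorm : ∀ i, ∀ t : ℝ, 0 ≤ t → ‖c i * exp ((ζ i - ζ i₀) * t)‖ ≤ ‖c i‖ := by
    intro i t ht
    by_cases hc : c i = 0
    · simp [hc]
    · rw [norm_mul]
      refine mul_le_of_le_one_right (norm_nonneg _) ?_
      rw [norm_exp, Real.exp_le_one_iff]
      have := hre i hc
      simp only [mul_re, sub_re, ofReal_re, ofReal_im, mul_zero, sub_zero, h0]
      exact mul_nonpos_of_nonpos_of_nonneg this ht
  have hsum0 : ∀ t : ℝ, ∑' i, c i * exp ((ζ i - ζ i₀) * t) = 0 := by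
    intro t
    have : ∀ i, c i * exp ((ζ i - ζ i₀) * t) = exp (-(ζ i₀ * t)) * (c i * exp (ζ i * t)) := by
      intro i
      rw [mul_left_comm, ← exp_add]
      ring_nf
    rw [tsum_congr this, tsum_mul_left, hf, mul_zero]
  -- After division by exp(ζ_{i₀} t), averaging over [0, T] as T → ∞ kills every term except i₀;
  -- dominated convergence by |c_i| justifies both exchanges.
  have hint : ∀ T : ℝ, 0 < T →
      ∑' i, c i * ((∫ t in (0 : ℝ)..T, exp ((ζ i - ζ i₀) * t)) / T) = 0 := by
    intro T hT
    have hsumm : ∀ t : ℝ, 0 ≤ t → Summable fun i => c i * exp ((ζ i - ζ i₀) * t) := fun t ht =>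
      Summable.of_norm_bounded hs fun i => hnorm i t ht
    have h := intervalIntegral.hasSum_integral_of_dominated_convergence
      (μ := MeasureTheory.volume) (a := 0) (b := T)
      (F := fun i (t : ℝ) => c i * exp ((ζ i - ζ i₀) * t)) (f := fun _ => 0)
      (fun i _ => ‖c i‖)
      (fun i => Continuous.aestronglyMeasurable (by fun_prop))
      (fun i => Filter.Eventually.of_forall fun t ht => hnorm i t (by
        rw [Set.uIoc_of_le hT.le] at ht; exact ht.1.le))
      (Filter.Eventually.of_forall fun t _ => hs)
      (by simp)
      (Filter.Eventually.of_forall fun t ht => by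
        rw [Set.uIoc_of_le hT.le] at ht
        have := (hsumm t ht.1.le).hasSum
        rwa [hsum0 t] at this)
    simp only [intervalIntegral.integral_zero] at h
    have h2 := (h.div_const (T : ℂ)).tsum_eq
    rw [zero_div] at h2
    rw [← h2]
    refine tsum_congr fun i => ?_
    rw [intervalIntegral.integral_const_mul, mul_div_assoc]
  have hlim := tendsto_tsum_of_dominated_convergence (𝓕 := Filter.atTop)
    (f := fun (T : ℝ) i => c i * ((∫ t in (0 : ℝ)..T, exp ((ζ i - ζ i₀) * t)) / T))
    (g := fun i => if i = i₀ then c i else 0) (bound := fun i => ‖c i‖) hs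
    (fun i => by
      by_cases hi : i = i₀
      · rw [if_pos hi, hi]
        refine tendsto_const_nhds.congr' ?_
        filter_upwards [Filter.eventually_gt_atTop 0] with T hT
        have : (T : ℂ) ≠ 0 := by exact_mod_cast hT.ne'
        simp [this]
      · rw [if_neg hi]
        by_cases hc : c i = 0
        · simp [hc]
        · have := (tendsto_average_exp (sub_ne_zero.mpr (hne i hi hc))
            (by rw [sub_re, h0, sub_zero]; exact hre i hc)).const_mul (c i)
          rwa [mul_zero] at this)
    (by
      filter_upwards [Filter.eventually_gt_atTop 0] with T hT i
      rw [← mul_div_assoc, ← intervalIntegral.integral_const_mul, norm_div, norm_real,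
        Real.norm_eq_abs, abs_of_pos hT, div_le_iff₀ hT]
      have := intervalIntegral.norm_integral_le_of_norm_le_const (a := 0) (b := T) (C := ‖c i‖)
        (f := fun t : ℝ => c i * exp ((ζ i - ζ i₀) * t)) fun t ht => hnorm i t (by
          rw [Set.uIoc_of_le hT.le] at ht; exact ht.1.le)
      rwa [sub_zero, abs_of_pos hT] at this)
  have hzero : Filter.Tendsto (fun T : ℝ =>
      ∑' i, c i * ((∫ t in (0 : ℝ)..T, exp ((ζ i - ζ i₀) * t)) / T)) Filter.atTop (𝓝 0) := by
    refine tendsto_const_nhds.congr' ?_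
    filter_upwards [Filter.eventually_gt_atTop 0] with T hT
    exact (hint T hT).symm
  have := tendsto_nhds_unique hlim hzero
  rwa [tsum_ite_eq] at this

namespace GammaData

variable (D : GammaData)

/-- As all λ_j are positive, only the all-plus choice reaches the top frequency, so its coefficient
is a single product and cannot cancel. -/
theorem signFreq_eq_half_iff (hd : 0 < D.degree) (ε : Fin D.r → ℤˣ) :
    D.signFreq ε = 1 / 2 ↔ ε = fun _ => 1 := by
  rw [signFreq, div_eq_iff hd.ne', degree, ← mul_assoc, one_div_mul_cancel two_ne_zero, one_mul,
    eq_comm, ← sub_eq_zero, ← Finset.sum_sub_distrib, Finset.sum_eq_zero_iff_of_nonneg]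
  · constructor
    · intro h
      funext j
      have := h j (Finset.mem_univ j)
      rcases Int.units_eq_one_or (ε j) with h' | h'
      · exact h'
      · rw [h'] at this
        have hl := D.lam_pos j
        simp at this
        linarith
    · rintro rfl j _
      simp
  · intro j _
    have hl := D.lam_pos j
    rcases Int.units_eq_one_or (ε j) with h' | h' <;> (simp [h']; try linarith)

theorem half_mem_freqs (hd : 0 < D.degree) : (1 / 2 : ℝ) ∈ D.freqs :=
  Finset.mem_image.mpr ⟨_, Finset.mem_univ _, (D.signFreq_eq_half_iff hd _).mpr rfl⟩

theorem coeff_half_ne_zero (hd : 0 < D.degree) : D.coeff (1 / 2) ≠ 0 := by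
  have : Finset.univ.filter (fun ε => D.signFreq ε = 1 / 2) = {fun _ => 1} := by
    ext ε
    simp only [Finset.mem_filter, Finset.mem_univ, true_and, Finset.mem_singleton]
    exact D.signFreq_eq_half_iff hd ε
  rw [coeff, this, Finset.sum_singleton, signCoeff, Finset.prod_ne_zero_iff]
  intro j _
  simp

/-- The exponent of `t` in the `(w, n)`-th term of `F̄_ℓ(2 + it, α)`. -/
noncomputable def lineExp (α w : ℝ) (n : ℕ) : ℂ :=
  Real.pi * D.degree * w - I * log n - I * D.degree * log (1 + D.shift α w n)

theorem freqExp_mul_innerTerm (hd : 0 < D.degree) (a : ℕ → ℂ) (l : ℕ) {α : ℝ} (hα : 0 < α) {w : ℝ}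
    (h1 : -(1 / 2) ≤ w) (h2 : w ≤ 1 / 2) (n : ℕ) (t : ℝ) :
    D.freqExp w (2 + t * I) * D.innerTerm a l α w (2 + t * I) n =
      D.freqExp w 2 * D.innerTerm a l α w 2 n * exp (D.lineExp α w n * t) := by
  rw [D.innerTerm_eq, D.innerTerm_eq, powTerm, powTerm]
  split_ifs with h
  · simp
  · rw [not_or] at h
    have hv := D.shift_ne_neg_one hd hα h1 h2 h.1 h.2
    have hn : (n : ℂ) ≠ 0 := by exact_mod_cast h.1
    have e1 : D.freqExp w (2 + t * I) = D.freqExp w 2 * exp (Real.pi * D.degree * w * t) := by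
      rw [freqExp, freqExp, ← exp_add]
      congr 1
      linear_combination (-(Real.pi * D.degree * w * t : ℂ)) * I_mul_I
    have e2 : LSeries.term (fun n => conj (a n)) (2 + t * I) n =
        LSeries.term (fun n => conj (a n)) 2 n * exp (-(I * log n) * t) := by
      rw [term_add_right, cpow_def_of_ne_zero hn]
      ring_nf
    have e3 : (1 + D.shift α w n) ^ D.expo l (2 + t * I) =
        (1 + D.shift α w n) ^ D.expo l 2 * exp (-(I * D.degree * log (1 + D.shift α w n)) * t) := by
      rw [cpow_def_of_ne_zero hv, cpow_def_of_ne_zero hv, ← exp_add, expo, expo]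
      ring_nf
    have e4 : exp (D.lineExp α w n * t) = exp (Real.pi * D.degree * w * t) *
        exp (-(I * log n) * t) * exp (-(I * D.degree * log (1 + D.shift α w n)) * t) := by
      rw [← exp_add, ← exp_add, lineExp]
      ring_nf
    rw [e1, e2, e3, e4]
    ring

theorem ne_of_innerTerm_ne_zero {a : ℕ → ℂ} {l : ℕ} {α w : ℝ} {s : ℂ} {n : ℕ}
    (h : D.innerTerm a l α w s n ≠ 0) : n ≠ 0 ∧ ¬(w = -(1 / 2) ∧ (n : ℝ) = D.nAlpha α) := by
  rw [← not_or]
  intro h'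
  exact h (by rw [innerTerm, if_pos h'])

theorem innerTerm_ne_zero {a : ℕ → ℂ} {l : ℕ} {α w : ℝ} {s : ℂ} {n : ℕ} (hn : n ≠ 0) (ha : a n ≠ 0)
    (h : ¬(w = -(1 / 2) ∧ (n : ℝ) = D.nAlpha α)) (hv : 1 + D.shift α w n ≠ 0) :
    D.innerTerm a l α w s n ≠ 0 := by
  have hn' : (n : ℂ) ≠ 0 := by exact_mod_cast hn
  rw [D.innerTerm_eq, powTerm, if_neg (not_or.mpr ⟨hn, h⟩), LSeries.term, if_neg hn]
  refine mul_ne_zero (div_ne_zero (by simpa using ha) ?_) ?_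
  · rw [Ne, cpow_eq_zero_iff]; exact fun h => hn' h.1
  · rw [Ne, cpow_eq_zero_iff]; exact fun h => hv h.1

theorem exp_I_mul_half_sub (w : ℝ) :
    I * Real.pi * (1 / 2 - w) = ((Real.pi * (1 / 2 - w) : ℝ) : ℂ) * I := by push_cast; ring

theorem lineExp_re_le (hd : 0 < D.degree) {α : ℝ} (hα : 0 < α) {w : ℝ}
    (h1 : -(1 / 2) ≤ w) (h2 : w ≤ 1 / 2) (n : ℕ) :
    (D.lineExp α w n).re ≤ Real.pi / 2 * D.degree := by
  have hpos := D.nAlpha_pos hd hα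
  have harg := (arg_one_add_exp_mem (φ := Real.pi * (1 / 2 - w))
    (ρ := (D.nAlpha α / n) ^ (1 / D.degree)) (mul_nonneg Real.pi_pos.le (by linarith))
    (by nlinarith [Real.pi_pos]) (by positivity)).2
  rw [← exp_I_mul_half_sub] at harg
  have hre : (D.lineExp α w n).re =
      Real.pi * D.degree * w + D.degree * arg (1 + D.shift α w n) := by
    simp [lineExp, log_im]
  rw [hre, shift]
  linear_combination D.degree * harg

theorem lineExp_half_re (hd : 0 < D.degree) {α : ℝ} (hα : 0 < α) (n : ℕ) :
    (D.lineExp α (1 / 2) n).re = Real.pi / 2 * D.degree := by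
  have hpos := D.nAlpha_pos hd hα
  have hs : 1 + D.shift α (1 / 2) n = ((1 + (D.nAlpha α / n) ^ (1 / D.degree) : ℝ) : ℂ) := by
    simp [shift]
  have harg : arg (1 + D.shift α (1 / 2) n) = 0 := by
    rw [hs, arg_ofReal_of_nonneg]
    positivity
  have hre : (D.lineExp α (1 / 2) n).re =
      Real.pi * D.degree * (1 / 2) + D.degree * arg (1 + D.shift α (1 / 2) n) := by
    simp [lineExp, log_im]
  rw [hre, harg]
  ring

/-- Because e^(iπw) e^(iπ(1/2-w)) = i, the second summand does not depend on (w, n). The exponent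
therefore determines e^(iπw) n^(1/d), whose modulus gives n and whose phase gives w in [-1/2, 1/2]
through the sine. -/
theorem exp_lineExp (hd : 0 < D.degree) {α : ℝ} (hα : 0 < α) {w : ℝ} {n : ℕ} (hn : n ≠ 0)
    (hv : 1 + D.shift α w n ≠ 0) :
    exp (I * D.lineExp α w n / D.degree) =
      exp ((Real.pi * w : ℝ) * I) * (((n : ℝ) ^ (1 / D.degree) : ℝ) : ℂ) +
        I * ((D.nAlpha α ^ (1 / D.degree) : ℝ) : ℂ) := by
  have hpos := D.nAlpha_pos hd hα
  have hn1 : (0 : ℝ) < n := by exact_mod_cast Nat.pos_of_ne_zero hn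
  have hd' : (D.degree : ℂ) ≠ 0 := by exact_mod_cast hd.ne'
  have e1 : I * D.lineExp α w n / D.degree =
      (Real.pi * w : ℝ) * I + log n * (1 / D.degree : ℝ) + log (1 + D.shift α w n) := by
    rw [lineExp]
    push_cast
    field_simp
    linear_combination (-(log n + D.degree * log (1 + D.shift α w n))) * I_mul_I
  have e2 : exp (log n * (1 / D.degree : ℝ)) = (((n : ℝ) ^ (1 / D.degree) : ℝ) : ℂ) := by
    rw [ofReal_cpow hn1.le, cpow_def_of_ne_zero (by exact_mod_cast hn), ofReal_natCast]
  have e3 : (((n : ℝ) ^ (1 / D.degree) : ℝ) : ℂ) *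
      (((D.nAlpha α / n) ^ (1 / D.degree) : ℝ) : ℂ) = ((D.nAlpha α ^ (1 / D.degree) : ℝ) : ℂ) := by
    rw [← ofReal_mul, ← Real.mul_rpow hn1.le (by positivity), mul_div_cancel₀ _ hn1.ne']
  have e4 : exp ((Real.pi * w : ℝ) * I) * exp (I * Real.pi * (1 / 2 - w)) = I := by
    rw [← exp_add]
    refine (congrArg exp ?_).trans exp_pi_div_two_mul_I
    push_cast
    ring
  rw [e1, exp_add, exp_add, exp_log hv, e2, shift]
  linear_combination exp ((Real.pi * w : ℝ) * I) * exp (I * Real.pi * (1 / 2 - w)) * e3 +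
    ((D.nAlpha α ^ (1 / D.degree) : ℝ) : ℂ) * e4

theorem eq_of_lineExp_eq (hd : 0 < D.degree) {α : ℝ} (hα : 0 < α) {w : ℝ}
    (h1 : -(1 / 2) ≤ w) (h2 : w ≤ 1 / 2) {n n₀ : ℕ} (hn : n ≠ 0) (hn₀ : n₀ ≠ 0)
    (hv : 1 + D.shift α w n ≠ 0) (hv₀ : 1 + D.shift α (1 / 2) n₀ ≠ 0)
    (h : D.lineExp α w n = D.lineExp α (1 / 2) n₀) : w = 1 / 2 ∧ n = n₀ := by
  have hn1 : (0 : ℝ) < n := by exact_mod_cast Nat.pos_of_ne_zero hn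
  have hn2 : (0 : ℝ) < n₀ := by exact_mod_cast Nat.pos_of_ne_zero hn₀
  have hE := D.exp_lineExp hd hα hn hv
  rw [h, D.exp_lineExp hd hα hn₀ hv₀, add_left_inj] at hE
  have hnorm := congrArg norm hE
  rw [norm_mul, norm_mul, norm_exp_ofReal_mul_I, norm_exp_ofReal_mul_I, one_mul, one_mul, norm_real,
    norm_real, Real.norm_of_nonneg (by positivity), Real.norm_of_nonneg (by positivity),
    Real.rpow_left_inj hn2.le hn1.le (by positivity)] at hnorm
  rw [hnorm] at hE
  have hx : (((n : ℝ) ^ (1 / D.degree) : ℝ) : ℂ) ≠ 0 := by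
    exact_mod_cast (Real.rpow_pos_of_pos hn1 _).ne'
  have him := congrArg im (mul_right_cancel₀ hx hE)
  rw [exp_ofReal_mul_I_im, exp_ofReal_mul_I_im] at him
  refine ⟨?_, by exact_mod_cast hnorm.symm⟩
  have := Real.injOn_sin (x₁ := Real.pi * (1 / 2)) (x₂ := Real.pi * w)
    ⟨by linarith [Real.pi_pos], by linarith⟩
    ⟨by nlinarith [Real.pi_pos], by nlinarith [Real.pi_pos]⟩ him
  exact (mul_left_cancel₀ Real.pi_ne_zero this).symm

end GammaData

namespace IsExtendedSelberg

variable {a : ℕ → ℂ} {F : ℂ → ℂ} {D : GammaData}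

theorem exists_coeff_ne_zero (hF : IsExtendedSelberg a F D) : ∃ n : ℕ, n ≠ 0 ∧ a n ≠ 0 := by
  by_contra! h
  obtain ⟨s, hs, hne⟩ := hF.ne_zero
  apply hne
  rw [hF.eq_LSeries s hs, LSeries]
  have : ∀ n, LSeries.term a s n = 0 := fun n => by
    rw [LSeries.term]
    split_ifs with hn
    · rfl
    · rw [h n hn, zero_div]
  simp [this]

theorem exists_fBar_ne_zero (hF : IsExtendedSelberg a F D) (hd : 0 < D.degree) (l : ℕ) {α : ℝ}
    (hα : 0 < α) : ∃ s : ℂ, 1 < s.re ∧ D.fBar a l α s ≠ 0 := by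
  by_contra! hzero
  obtain ⟨n₀, hn₀, ha⟩ := hF.exists_coeff_ne_zero
  have hw : ∀ w : D.freqs, -(1 / 2) ≤ (w : ℝ) ∧ (w : ℝ) ≤ 1 / 2 := fun w =>
    D.abs_le_half_of_mem_freqs hd w.2
  set c : D.freqs × ℕ → ℂ := fun i =>
    D.coeff i.1 * (D.freqExp i.1 2 * D.innerTerm a l α i.1 2 i.2) with hc
  -- Subtracting πd/2 makes all relevant real parts nonpositive, and zero for w = 1/2.
  set ζ : D.freqs × ℕ → ℂ := fun i =>
    D.lineExp α i.1 i.2 - (Real.pi / 2 * D.degree : ℝ) with hζ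
  have hsin : ∀ w : D.freqs, ∀ s : ℂ, 1 < s.re → Summable fun n => D.innerTerm a l α w s n :=
    fun w s hs => hF.summable_innerTerm hd hα w.2 l hs
  have hnz : ∀ i : D.freqs × ℕ, c i ≠ 0 → i.2 ≠ 0 ∧ 1 + D.shift α i.1 i.2 ≠ 0 := by
    intro i hi
    have h1 : D.innerTerm a l α i.1 2 i.2 ≠ 0 := fun h => hi (by rw [hc]; simp [h])
    have h2 := D.ne_of_innerTerm_ne_zero h1
    exact ⟨h2.1, D.shift_ne_neg_one hd hα (hw i.1).1 (hw i.1).2 h2.1 h2.2⟩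
  have hsum : Summable fun i => ‖c i‖ := by
    rw [summable_prod_of_nonneg fun _ => norm_nonneg _]
    refine ⟨fun w => ?_, (hasSum_fintype _).summable⟩
    exact (((hsin w 2 (by simp)).mul_left (D.freqExp w 2)).mul_left (D.coeff w)).norm
  -- Omission concerns only w = -1/2, so the term (1/2, n₀) is present even if n₀ = n_α.
  have hv₀ : 1 + D.shift α (1 / 2) n₀ ≠ 0 :=
    D.shift_ne_neg_one hd hα (by norm_num) le_rfl hn₀ (by norm_num)
  have h0 := coeff_eq_zero_of_tsum_exp_eq_zero (c := c) (ζ := ζ)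
    (⟨1 / 2, D.half_mem_freqs hd⟩, n₀) hsum
    (fun i _ => by
      rw [hζ]
      simp only [sub_re, ofReal_re]
      linarith [D.lineExp_re_le hd hα (hw i.1).1 (hw i.1).2 i.2])
    (by
      rw [hζ]
      simp only [sub_re, ofReal_re]
      rw [D.lineExp_half_re hd hα, sub_self])
    (fun i hi hci heq => hi (by
      rw [hζ] at heq
      simp only [sub_left_inj] at heq
      have := D.eq_of_lineExp_eq hd hα (hw i.1).1 (hw i.1).2 (hnz i hci).1 hn₀ (hnz i hci).2 hv₀ heq
      exact Prod.ext (Subtype.ext this.1) this.2))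
    (fun t => by
      have hterm : ∀ i : D.freqs × ℕ, c i * exp (ζ i * t) =
          exp (-((Real.pi / 2 * D.degree : ℝ) * t)) * (D.coeff i.1 *
            (D.freqExp i.1 (2 + t * I) * D.innerTerm a l α i.1 (2 + t * I) i.2)) := by
        intro i
        have e : exp (ζ i * t) =
            exp (-((Real.pi / 2 * D.degree : ℝ) * t)) * exp (D.lineExp α i.1 i.2 * t) := by
          rw [hζ, ← exp_add]
          ring_nf
        rw [D.freqExp_mul_innerTerm hd a l hα (hw i.1).1 (hw i.1).2, hc, e]
        ring
      have hre : 1 < (2 + t * I : ℂ).re := by simp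
      rw [tsum_congr hterm, tsum_mul_left, Summable.tsum_prod', tsum_fintype]
      · have hz := hzero (2 + t * I) hre
        rw [GammaData.fBar, ← Finset.sum_coe_sort] at hz
        simp only [tsum_mul_left]
        simp only [mul_assoc] at hz ⊢
        simp only [GammaData.freqExp, mul_assoc]
        rw [hz, mul_zero]
      · refine Summable.of_norm ?_
        rw [summable_prod_of_nonneg fun _ => norm_nonneg _]
        refine ⟨fun w => ?_, (hasSum_fintype _).summable⟩
        exact (((hsin w (2 + t * I) hre).mul_left (D.freqExp w (2 + t * I))).mul_left
          (D.coeff w)).norm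
      · exact fun w => ((hsin w (2 + t * I) hre).mul_left (D.freqExp w (2 + t * I))).mul_left
          (D.coeff w))
  have h0' : D.coeff (1 / 2) * (D.freqExp (1 / 2) 2 * D.innerTerm a l α (1 / 2) 2 n₀) = 0 := h0
  have hf : D.freqExp (1 / 2) 2 ≠ 0 := exp_ne_zero _
  exact mul_ne_zero (D.coeff_half_ne_zero hd)
    (mul_ne_zero hf (D.innerTerm_ne_zero hn₀ ha (by norm_num) hv₀)) h0'

end IsExtendedSelberg

/-! ### Uniform exponents and conclusion -/

/-- The continuation of `F̄_ℓ(s, α)` has growth exponents in the strips `-M ≤ Re s ≤ 2` which depend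
only on `F` and `M`. -/
theorem IsExtendedSelberg.exists_growth_exponents {a : ℕ → ℂ} {F : ℂ → ℂ} {D : GammaData}
    (hF : IsExtendedSelberg a F D) (hd : 1 ≤ D.degree) :
    ∃ B : ℕ → ℕ, ∀ (l : ℕ) (α : ℝ), 0 < α → ∃ G : ℂ → ℂ, Differentiable ℂ G ∧
      (∀ s : ℂ, 1 < s.re → G s = D.fBar a l α s) ∧
      (∀ x y : ℝ, 1 < x → ∃ C : ℝ, 0 ≤ C ∧ ∀ s : ℂ, x ≤ s.re → s.re ≤ y →
        ‖G s‖ ≤ C * Real.exp (Real.pi / 2 * D.degree * |s.im|)) ∧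
      ∀ M : ℕ, ∃ C : ℝ, 0 ≤ C ∧ ∀ s : ℂ, -M ≤ s.re → s.re ≤ 2 → 1 ≤ |s.im| →
        ‖G s‖ ≤ C * Real.exp (Real.pi / 2 * D.degree * |s.im|) * |s.im| ^ B M := by
  have hd0 : 0 < D.degree := by linarith
  obtain ⟨h, hhd, hh⟩ := hF.exists_entire_sineProd_mul
  have hK : ∀ M : ℕ, ∃ K : ℕ, 1 < -(M : ℝ) + K / D.degree := fun M => by
    obtain ⟨K, hK⟩ := exists_nat_gt ((1 + M) * D.degree)
    refine ⟨K, ?_⟩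
    rw [← lt_div_iff₀ hd0] at hK
    linarith
  choose K hK using hK
  -- K, C and N are fixed before ℓ and α appear; this makes the exponents `K M + N M` independent of
  -- both.
  choose C N hC hN using fun M : ℕ => hF.exists_norm_sineProd_mul_le (-(M : ℝ)) (2 + K M)
  refine ⟨fun M => K M + N M, fun l α hα => ?_⟩
  obtain ⟨G, hGd, hG, hright, hleft⟩ := hF.exists_continuation hd hhd hh l hα
  refine ⟨G, hGd, hG, hright, fun M => hleft (K M) (-(M : ℝ)) 2 (C M) (N M) (hK M) ?_⟩
  intro s hx hy ht
  rw [hh s (by rintro rfl; norm_num at ht)]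
  exact hN M s hx hy ht

end ExtSelberg

theorem theorem1 (a : ℕ → ℂ) (F : ℂ → ℂ) (D : ExtSelberg.GammaData)
    (hF : ExtSelberg.IsExtendedSelberg a F D) (hd : 1 ≤ D.degree) :
    ∃ c : ℝ → ℝ, (∀ σ, 0 ≤ c σ) ∧ (∀ σ, 1 < σ → c σ = 0) ∧
      ∀ (l : ℕ) (α : ℝ), 0 < α →
        (∀ s : ℂ, 1 < s.re → ∀ w ∈ D.freqs, Summable (D.innerTerm a l α w s)) ∧
        ∃ G : ℂ → ℂ, Differentiable ℂ G ∧
          (∀ s : ℂ, 1 < s.re → G s = D.fBar a l α s) ∧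
          (∃ s : ℂ, G s ≠ 0) ∧
          (∀ x y δ : ℝ, 0 < δ → ∃ C : ℝ, ∀ s : ℂ, s.re ∈ Set.Icc x y →
            s.re ∉ Set.Ioo 1 (1 + δ) → 1 ≤ |s.im| →
            ‖G s‖ ≤ C * (Real.exp (Real.pi / 2 * D.degree * |s.im|) * |s.im| ^ c s.re)) ∧
          (∀ x y ε : ℝ, 0 < ε → ∃ C : ℝ, ∀ s : ℂ, s.re ∈ Set.Icc x y → 1 ≤ |s.im| →
            ‖G s‖ ≤ C * (Real.exp (Real.pi / 2 * D.degree * |s.im|) *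
              |s.im| ^ (c s.re + ε))) := by
  have hd0 : 0 < D.degree := by linarith
  obtain ⟨B, hB⟩ := hF.exists_growth_exponents hd
  -- A step function suffices, as no continuity of c is required. The natural ceiling is 0 for 0 ≤ σ
  -- ≤ 1, where the strip with M = 0 applies.
  set c : ℝ → ℝ := fun σ => if 1 < σ then 0 else B ⌈-σ⌉₊ with hc
  have hc0 : ∀ σ, 0 ≤ c σ := fun σ => by
    rw [hc]
    simp only
    split_ifs
    · exact le_rfl
    · exact Nat.cast_nonneg _
  refine ⟨c, hc0, fun σ hσ => if_pos hσ, fun l α hα =>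
    ⟨fun s hs w hw => hF.summable_innerTerm hd0 hα hw l hs, ?_⟩⟩
  obtain ⟨G, hGd, hG, hright, hleft⟩ := hB l α hα
  choose C hC hleft using hleft
  have hfirst : ∀ x y δ : ℝ, 0 < δ → ∃ C' : ℝ, 0 ≤ C' ∧ ∀ s : ℂ, s.re ∈ Set.Icc x y →
      s.re ∉ Set.Ioo 1 (1 + δ) → 1 ≤ |s.im| →
      ‖G s‖ ≤ C' * (Real.exp (Real.pi / 2 * D.degree * |s.im|) * |s.im| ^ c s.re) := by
    intro x y δ hδ
    obtain ⟨C₁, hC₁, H₁⟩ := hright (1 + δ) y (by linarith)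
    -- To the left of 1 only the finitely many strips with M ≤ ⌈-x⌉ occur, so the sum of their
    -- constants is a uniform one.
    have hS : 0 ≤ ∑ M ∈ range (⌈-x⌉₊ + 1), C M := Finset.sum_nonneg fun M _ => hC M
    refine ⟨C₁ + ∑ M ∈ range (⌈-x⌉₊ + 1), C M, by positivity, fun s hs hδs ht => ?_⟩
    rcases le_or_gt s.re 1 with h | h
    · have hM : ⌈-s.re⌉₊ ∈ range (⌈-x⌉₊ + 1) :=
        Finset.mem_range.mpr (Nat.lt_succ_of_le (Nat.ceil_mono (neg_le_neg hs.1)))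
      have h1 := Finset.single_le_sum (fun M _ => hC M) hM
      have h2 := hleft ⌈-s.re⌉₊ s (by linarith [Nat.le_ceil (-s.re)]) (by linarith) ht
      have h3 : c s.re = B ⌈-s.re⌉₊ := if_neg (not_lt.mpr h)
      rw [h3, Real.rpow_natCast, ← mul_assoc]
      refine h2.trans ?_
      gcongr
      linarith
    · have h1 : 1 + δ ≤ s.re := not_lt.mp fun h' => hδs ⟨h, h'⟩
      have h3 : c s.re = 0 := if_pos h
      rw [h3, Real.rpow_zero, mul_one]
      refine (H₁ s h1 hs.2).trans ?_
      gcongr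
      linarith
  refine ⟨G, hGd, hG, ?_, fun x y δ hδ => ?_, fun x y ε hε => ?_⟩
  · obtain ⟨s, hs, hne⟩ := hF.exists_fBar_ne_zero hd0 l hα
    exact ⟨s, by rwa [hG s hs]⟩
  · obtain ⟨C', -, H⟩ := hfirst x y δ hδ
    exact ⟨C', H⟩
  · obtain ⟨C₁, η, hC₁, hη, H₁⟩ := ExtSelberg.exists_norm_le_rpow_of_edges hGd
      (show 0 ≤ Real.pi / 2 * D.degree by positivity) (hC 0)
      (fun s hs => hleft 0 s (by simpa using hs))
      (fun x hx => by
        obtain ⟨C', hC', H⟩ := hright x x hx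
        exact ⟨C', hC', fun s hs => H s hs.ge hs.le⟩) hε
    -- The first estimate with δ = η covers everything outside the interval (1, 1 + η) handled by
    -- interpolation.
    obtain ⟨C₂, hC₂, H₂⟩ := hfirst x y η hη
    refine ⟨C₁ + C₂, fun s hs ht => ?_⟩
    by_cases h : s.re ∈ Set.Ioo 1 (1 + η)
    · have h3 : c s.re = 0 := if_pos h.1
      rw [h3, zero_add]
      refine (H₁ s h.1.le h.2.le ht).trans ?_
      gcongr
      linarith
    · refine (H₂ s hs h ht).trans ?_
      gcongr
      · linarith
      · linarith
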